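/- Let $m\ge 1$, $n\ge 2$. States are $X=[X_1,\dots,X_n]\in\mathbb{R}^{m\times n}\cong\mathbb{R}^{mn}$ with columns $X_i\in\mathbb{R}^m$, inputs are $U\in\mathbb{R}^m$, and $|\cdot|$ denotes a norm. Let $F:\mathbb{R}^{mn}\times\mathbb{R}^m\to\mathbb{R}^m$ be $C^1$ with $F(0,0)=0$ and with $\frac{\partial F}{\partial U}(0,0)$ nonsingular. For a perturbation $W:[0,\infty)\times\mathbb{R}^{mn}\to\mathbb{R}^m$ and a feedback $G:P\to\mathbb{R}^m$ on an open neighbourhood $P$ of $0\in\mathbb{R}^{mn}$, consider the closed loop in $P$ $$\dot X_i=X_{i+1}\ (1\le i\le n-1),\qquad \dot X_n=F(X,G(X))+W(t,X).\tag{1}$$ Definitions. A continuous $h:[0,\infty)\to\mathbb{R}^m$ is *diminishing* if $\sup_{0\le\lambda\le1}\left|\int_t^{t+\lambda}h(\tau)\,d\tau\right|\to0$ as $t\to\infty$. The origin is *eventually uniform-asymptotically stable* (EvUAS) for (1) if * for every $\varepsilon>0$ there are $\alpha\ge0$ and $\delta>0$ such that, for all $t_0\ge\alpha$ and $|x_0|<\delta$,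 the solutions $x$ of (1) with $x(t_0)=x_0$ exist on $[t_0,\infty)$ and satisfy $|x(t)|<\varepsilon$ for all $t\ge t_0$; and * there are $\delta_0>0$ and $\alpha_0\ge0$ such that for every $\varepsilon>0$ there is $T\ge0$ such that, for all $t_0\ge\alpha_0$ and $|x_0|<\delta_0$, the solutions $x$ of (1) with $x(t_0)=x_0$ exist on $[t_0,\infty)$ and satisfy $|x(t)|<\varepsilon$ for all $t\ge t_0+T$. Here "the solutions exist on $[t_0,\infty)$" means that there is at least one solution on $[t_0,\infty)$ and that every solution on an interval $[t_0,t_1)$ extends to one on $[t_0,\infty)$; uniqueness of solutions is not assumed. (i) There are an open neighbourhood $P$ of $0\in\mathbb{R}^{mn}$ and a $C^1$ feedback $G:P\to\mathbb{R}^m$ with $G(0)=0$, making $X\mapsto F(X,G(X))$ the restriction to $P$ of a linear map, such that the origin is EvUAS for (1) whenever $W(t,X)=D(t)K(X)$, where $K:\mathbb{R}^{mn}\to\mathbb{R}^m$ is continuous and each column of the $m\times m$ matrix $D(t)$ is continuous on $[0,\infty)$, diminishing and, if $K$ is not constant, bounded on $[0,\infty)$. (ii) Conversely, let $W(t,X)=w(t)$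 with $w:[0,\infty)\to\mathbb{R}^m$ continuous, and let $G$ be any continuous feedback with $G(0)=0$ on an open neighbourhood $P$ of $0$. If the origin is EvUAS for (1), then $w$ is diminishing. (iii) If, moreover, for every $X\in\mathbb{R}^{mn}$ the function $U\mapsto\frac12|F(X,U)|^2$ is coercive (tends to $\infty$ as $|U|\to\infty$) and $\frac{\partial F}{\partial U}(X,U)$ is invertible for all $(X,U)\in\mathbb{R}^{mn}\times\mathbb{R}^m$, then the feedback $G$ in (i) can be taken to be defined on all of $\mathbb{R}^{mn}$, that is, $P=\mathbb{R}^{mn}$. -/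

import Mathlib

open Set Filter Topology

noncomputable section

/-- The input space `ℝᵐ` with its Euclidean norm. -/
abbrev Input (m : ℕ) : Type := EuclideanSpace ℝ (Fin m)

/-- The state space `ℝ^{m × n} = ℝ^{mn}`: a state is `X = [X₁, …, Xₙ]` with columns `Xᵢ ∈ ℝᵐ`
(indexed from `0`), with the norm `max_i ‖Xᵢ‖`. All the notions below are unchanged when the norm
is replaced by another norm of this finite-dimensional space. -/
abbrev State (m n : ℕ) : Type := Fin n → Input m

section ODE

variable {E : Type*} [NormedAddCommGroup E] [NormedSpace ℝ E]

/-- `x` solves `ẋ = v t x` on the time set `I` and stays in the domain `P` of the vector field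
(at an end point of `I` that belongs to `I` the derivative is one-sided). -/
def IsSolutionOn (v : ℝ → E → E) (P : Set E) (x : ℝ → E) (I : Set ℝ) : Prop :=
  ∀ t ∈ I, x t ∈ P ∧ HasDerivWithinAt x (v t (x t)) I t

/-- The solutions of `ẋ = v t x` in `P` that start at `(t₀, x₀)` exist for all `t ≥ t₀`: there is
one on `[t₀, ∞)`, and every solution on some `[t₀, T)` extends to one on `[t₀, ∞)`. -/
def ForwardComplete (v : ℝ → E → E) (P : Set E) (t₀ : ℝ) (x₀ : E) : Prop :=
  (∃ x, IsSolutionOn v P x (Ici t₀) ∧ x t₀ = x₀) ∧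
  ∀ T, t₀ < T → ∀ x, IsSolutionOn v P x (Ico t₀ T) → x t₀ = x₀ →
    ∃ y, IsSolutionOn v P y (Ici t₀) ∧ EqOn x y (Ico t₀ T)

/-- The origin is eventually uniformly stable for `ẋ = v t x` in `P`. -/
def EvUS (v : ℝ → E → E) (P : Set E) : Prop :=
  ∀ ε > 0, ∃ α ≥ 0, ∃ δ > 0, ∀ t₀ ≥ α, ∀ x₀ : E, ‖x₀‖ < δ →
    ForwardComplete v P t₀ x₀ ∧
    ∀ x, IsSolutionOn v P x (Ici t₀) → x t₀ = x₀ → ∀ t ≥ t₀, ‖x t‖ < ε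

/-- The origin is eventually uniformly attracting for `ẋ = v t x` in `P`. -/
def EvUA (v : ℝ → E → E) (P : Set E) : Prop :=
  ∃ δ₀ > 0, ∃ α₀ ≥ 0, ∀ ε > 0, ∃ T ≥ 0, ∀ t₀ ≥ α₀, ∀ x₀ : E, ‖x₀‖ < δ₀ →
    ForwardComplete v P t₀ x₀ ∧
    ∀ x, IsSolutionOn v P x (Ici t₀) → x t₀ = x₀ → ∀ t ≥ t₀ + T, ‖x t‖ < ε

/-- The origin is eventually uniform-asymptotically stable for `ẋ = v t x` in `P`. -/
def EvUAS (v : ℝ → E → E) (P : Set E) : Prop := EvUS v P ∧ EvUA v P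

/-- A continuous `h : [0, ∞) → E` is diminishing if
`sup_{0 ≤ l ≤ 1} ‖∫ τ in t..t+l, h τ‖ → 0` as `t → ∞`. Only the values on `[0, ∞)` matter. -/
def Diminishing (h : ℝ → E) : Prop :=
  ContinuousOn h (Ici 0) ∧
  Tendsto (fun t : ℝ => ⨆ l : Icc (0 : ℝ) 1, ‖∫ τ in t..(t + (l : ℝ)), h τ‖) atTop (𝓝 0)

end ODE

/-- The right-hand side of the closed loop `Ẋᵢ = Xᵢ₊₁` (`i < n`), `Ẋₙ = F(X, G(X)) + W(t, X)`. -/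
def closedLoop {m n : ℕ} (F : State m n × Input m → Input m) (G : State m n → Input m)
    (W : ℝ → State m n → Input m) (t : ℝ) (X : State m n) : State m n :=
  fun i => if h : (i : ℕ) + 1 < n then X ⟨(i : ℕ) + 1, h⟩ else F (X, G X) + W t X

/-- The `j`-th column of a time-dependent `m × m` matrix. -/
def column {m : ℕ} (D : ℝ → Matrix (Fin m) (Fin m) ℝ) (j : Fin m) (t : ℝ) : Input m :=
  WithLp.toLp 2 fun i => D t i j

/-- The perturbation `W(t, X) = D(t) K(X)`. -/
def perturbation {m n : ℕ} (D : ℝ → Matrix (Fin m) (Fin m) ℝ) (K : State m n → Input m)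
    (t : ℝ) (X : State m n) : Input m :=
  WithLp.toLp 2 (Matrix.mulVec (D t) (K X).ofLp)

/-- `K` is continuous, each column of `D` is (continuous on `[0, ∞)` and) diminishing and, if `K`
is not constant, also bounded on `[0, ∞)`. -/
def AdmissiblePerturbation {m n : ℕ} (D : ℝ → Matrix (Fin m) (Fin m) ℝ)
    (K : State m n → Input m) : Prop :=
  Continuous K ∧ (∀ j, Diminishing (column D j)) ∧
  ((¬ ∃ c, ∀ X, K X = c) → ∀ j, ∃ C : ℝ, ∀ t ≥ 0, ‖column D j t‖ ≤ C)

end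

/-! The feedback is defined by solving `F (X, G X) = L X`, where `L` is the gain that places every
pole of the chain of integrators at `-1`. The implicit function theorem solves this near the origin;
under coercivity and invertibility Hadamard's global inverse function theorem solves it everywhere.

The closed loop is then a stable linear chain with an additive input. In the coordinates `(d/dt +
1)ⁱ X₀` it is a cascade of scalar-type equations `ż = -z + u`, only the last of which sees the
perturbation. Replacing `z` by `z` minus a primitive of the perturbation shows that only integrals
over intervals of length at most one matter (`norm_le_of_norm_integral_le`, `exists_chain_decay`).
Along a solution confined to a ball these integrals are small at late times, because `K (x t)`
varies slowly compared with the averaging scale of `D`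
(`AdmissiblePerturbation.exists_norm_integral_le`). A first-exit argument and Peano existence turn
the decay estimate into stability (`evUAS_of_decay`).

For the converse, integrating the last equation along a solution that tends to `0` expresses the
integral of `w` through quantities that tend to `0`. -/

noncomputable section

/-! ### Existence of solutions by Euler polygons -/

section Peano

variable {E : Type*} [NormedAddCommGroup E] [NormedSpace ℝ E]

/-- The nodes of the Euler polygon with step `h` for `ẋ = v t x`, `x t₀ = x₀`. -/
def eulerNode (v : ℝ → E → E) (t₀ : ℝ) (x₀ : E) (h : ℝ) : ℕ → E
  | 0 => x₀
  | j + 1 => eulerNode v t₀ x₀ h j + h • v (t₀ + j * h) (eulerNode v t₀ x₀ h j)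

/-- Each of the `k - i` steps deviates from `h • c` by at most `h * ε`, and the deviations add up.
-/
lemma norm_eulerNode_sub_sub_le {v : ℝ → E → E} {t₀ : ℝ} {x₀ : E} {h : ℝ} (hh : 0 ≤ h) {c : E}
    {ε : ℝ} {i k : ℕ} (hik : i ≤ k)
    (hv : ∀ j, i ≤ j → j < k → ‖v (t₀ + j * h) (eulerNode v t₀ x₀ h j) - c‖ ≤ ε) :
    ‖eulerNode v t₀ x₀ h k - eulerNode v t₀ x₀ h i - (((k : ℝ) - i) * h) • c‖
      ≤ ((k : ℝ) - i) * h * ε := by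
  induction k, hik using Nat.le_induction with
  | base => simp
  | succ k hik ih =>
    have h1 := ih fun j hj hjk => hv j hj (hjk.trans k.lt_succ_self)
    have h2 := hv k hik k.lt_succ_self
    have h3 : eulerNode v t₀ x₀ h (k + 1) - eulerNode v t₀ x₀ h i
          - ((((k + 1 : ℕ) : ℝ) - i) * h) • c
        = (eulerNode v t₀ x₀ h k - eulerNode v t₀ x₀ h i - (((k : ℝ) - i) * h) • c)
          + h • (v (t₀ + k * h) (eulerNode v t₀ x₀ h k) - c) := by
      simp only [eulerNode]
      push_cast
      module
    rw [h3]
    refine (norm_add_le _ _).trans ?_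
    rw [norm_smul, Real.norm_of_nonneg hh]
    have := mul_le_mul_of_nonneg_left h2 hh
    push_cast
    linarith

lemma norm_eulerNode_sub_le {v : ℝ → E → E} {t₀ : ℝ} {x₀ : E} {h : ℝ} (hh : 0 ≤ h)
    {M : ℝ} {i k : ℕ} (hik : i ≤ k)
    (hv : ∀ j, i ≤ j → j < k → ∀ y, ‖v (t₀ + j * h) y‖ ≤ M) :
    ‖eulerNode v t₀ x₀ h k - eulerNode v t₀ x₀ h i‖ ≤ ((k : ℝ) - i) * h * M := by
  simpa using norm_eulerNode_sub_sub_le (c := 0) (x₀ := x₀) hh hik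
    (fun j hj hjk => by simpa using hv j hj hjk _)

/-- The piecewise constant interpolation of the nodes of the Euler polygon. -/
def eulerCurve (v : ℝ → E → E) (t₀ : ℝ) (x₀ : E) (h t : ℝ) : E :=
  eulerNode v t₀ x₀ h ⌊(t - t₀) / h⌋₊

lemma floor_div_mul_le {h s : ℝ} (hh : 0 < h) (hs : 0 ≤ s) : (⌊s / h⌋₊ : ℝ) * h ≤ s :=
  (le_div_iff₀ hh).1 (Nat.floor_le (by positivity))

lemma lt_floor_div_mul_add {h s : ℝ} (hh : 0 < h) : s < (⌊s / h⌋₊ : ℝ) * h + h := by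
  have := (div_lt_iff₀ hh).1 (Nat.lt_floor_add_one (s / h))
  linarith

lemma norm_eulerCurve_sub_le {v : ℝ → E → E} {t₀ : ℝ} {x₀ : E} {h : ℝ} (hh : 0 < h)
    {M T : ℝ} (hv : ∀ t, t₀ ≤ t → t ≤ T → ∀ y, ‖v t y‖ ≤ M) {t : ℝ} (ht : t₀ ≤ t) (htT : t ≤ T) :
    ‖eulerCurve v t₀ x₀ h t - x₀‖ ≤ (t - t₀) * M := by
  have hM : 0 ≤ M := (norm_nonneg _).trans (hv t ht htT 0)
  have h1 := floor_div_mul_le hh (sub_nonneg.2 ht)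
  have := norm_eulerNode_sub_le (v := v) (t₀ := t₀) (x₀ := x₀) (M := M) hh.le
    (Nat.zero_le ⌊(t - t₀) / h⌋₊) (fun j _ hj y => by
      have : (j : ℝ) * h ≤ (⌊(t - t₀) / h⌋₊ : ℝ) * h := by gcongr
      exact hv _ (by have := mul_nonneg j.cast_nonneg hh.le; linarith) (by linarith) y)
  refine this.trans ?_
  simp only [Nat.cast_zero, sub_zero]
  gcongr

/-- One-step consistency of the Euler scheme near a reference point `(s, p)` at which the field
has the approximate value `c`. -/
lemma norm_eulerCurve_sub_sub_le {v : ℝ → E → E} {t₀ : ℝ} {x₀ : E} {h : ℝ} (hh : 0 < h)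
    {M a b s δ ε : ℝ} (ha : t₀ ≤ a) (hab : a ≤ b) (hs : s = a ∨ s = b)
    (hM : ∀ t, t₀ ≤ t → t ≤ b → ∀ y, ‖v t y‖ ≤ M) {p c : E}
    (hv : ∀ t y, |t - s| < δ → ‖y - p‖ < δ → ‖v t y - c‖ ≤ ε)
    (h1 : b - a + h < δ) (h2 : (b - a + h) * M + ‖eulerCurve v t₀ x₀ h s - p‖ < δ) :
    ‖eulerCurve v t₀ x₀ h b - eulerCurve v t₀ x₀ h a - (b - a) • c‖
      ≤ (b - a + h) * ε + h * ‖c‖ := by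
  set i := ⌊(a - t₀) / h⌋₊ with hi
  set k := ⌊(b - t₀) / h⌋₊ with hk
  have hik : i ≤ k := Nat.floor_mono (by gcongr)
  have i1 : (i : ℝ) * h ≤ a - t₀ := floor_div_mul_le hh (sub_nonneg.2 ha)
  have i2 : a - t₀ < i * h + h := lt_floor_div_mul_add hh
  have k1 : (k : ℝ) * h ≤ b - t₀ := floor_div_mul_le hh (by linarith)
  have k2 : b - t₀ < k * h + h := lt_floor_div_mul_add hh
  have hM0 : 0 ≤ M := (norm_nonneg _).trans (hM a ha hab 0)
  have hε : 0 ≤ ε := (norm_nonneg _).trans (hv s p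
    (by rw [sub_self, abs_zero]; linarith) (by rw [sub_self, norm_zero]; linarith))
  have hMj : ∀ j : ℕ, j < k → ∀ y, ‖v (t₀ + j * h) y‖ ≤ M := fun j hj y => by
    have : (j : ℝ) * h ≤ k * h := by gcongr
    exact hM _ (by have := mul_nonneg j.cast_nonneg hh.le; linarith) (by linarith) y
  have key : ∀ j : ℕ, i ≤ j → j < k → ‖v (t₀ + j * h) (eulerNode v t₀ x₀ h j) - c‖ ≤ ε := by
    intro j hij hjk
    have j1 : (i : ℝ) * h ≤ j * h := by gcongr
    have j2 : (j : ℝ) * h ≤ k * h := by gcongr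
    refine hv _ _ ?_ ?_
    · rw [abs_lt]
      rcases hs with rfl | rfl <;> constructor <;> linarith
    · have : ‖eulerNode v t₀ x₀ h j - eulerCurve v t₀ x₀ h s‖ ≤ (b - a + h) * M := by
        rcases hs with rfl | rfl
        · refine (norm_eulerNode_sub_le hh.le hij fun l _ hl => hMj l (hl.trans hjk)).trans ?_
          gcongr
          linarith
        · rw [norm_sub_rev]
          refine (norm_eulerNode_sub_le hh.le hjk.le fun l _ hl => hMj l hl).trans ?_
          gcongr
          linarith
      have h3 := norm_add_le (eulerNode v t₀ x₀ h j - eulerCurve v t₀ x₀ h s)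
        (eulerCurve v t₀ x₀ h s - p)
      rw [sub_add_sub_cancel] at h3
      linarith
  have main := norm_eulerNode_sub_sub_le hh.le hik key
  have e : eulerCurve v t₀ x₀ h b - eulerCurve v t₀ x₀ h a - (b - a) • c
      = (eulerNode v t₀ x₀ h k - eulerNode v t₀ x₀ h i - (((k : ℝ) - i) * h) • c)
        + (((k : ℝ) - i) * h - (b - a)) • c := by
    simp only [eulerCurve, ← hi, ← hk]
    module
  rw [e]
  refine (norm_add_le _ _).trans (add_le_add (main.trans ?_) ?_)
  · gcongr
    linarith
  · rw [norm_smul]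
    gcongr
    rw [Real.norm_eq_abs, abs_le]
    constructor <;> linarith

/-- **Peano's theorem** on a half-line, for fields that are bounded on every compact time
interval. -/
theorem exists_solution_of_continuous [FiniteDimensional ℝ E] {v : ℝ → E → E}
    (hv : Continuous fun q : ℝ × E => v q.1 q.2) (t₀ : ℝ) (x₀ : E)
    (hM : ∀ T, ∃ M, ∀ t, t₀ ≤ t → t ≤ T → ∀ y, ‖v t y‖ ≤ M) :
    ∃ x : ℝ → E, x t₀ = x₀ ∧ ∀ t ∈ Ici t₀, HasDerivWithinAt x (v t (x t)) (Ici t₀) t := by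
  set h : ℕ → ℝ := fun n => 1 / ((n : ℝ) + 1) with hh
  have h0 : ∀ n, 0 < h n := fun n => Nat.one_div_pos_of_nat
  set X : ℕ → ℝ → E := fun n => eulerCurve v t₀ x₀ (h n) with hX
  -- Limits along a nonprincipal ultrafilter exist at every time at once, by compactness of balls,
  -- so no Arzelà–Ascoli subsequence has to be extracted.
  set 𝒰 : Ultrafilter ℕ := hyperfilter ℕ with h𝒰
  have hle : (𝒰 : Filter ℕ) ≤ atTop := Nat.hyperfilter_le_atTop
  have hlim : Tendsto h 𝒰 (𝓝 0) := (tendsto_one_div_add_atTop_nhds_zero_nat (𝕜 := ℝ)).mono_left hle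
  have hex : ∀ t, ∃ y, t₀ ≤ t → Tendsto (fun n => X n t) 𝒰 (𝓝 y) := by
    intro t
    by_cases ht : t₀ ≤ t
    · obtain ⟨M, hM⟩ := hM t
      have hc : IsCompact (Metric.closedBall x₀ ((t - t₀) * M)) := isCompact_closedBall _ _
      obtain ⟨y, -, hy⟩ := hc.ultrafilter_le_nhds (𝒰.map fun n => X n t) (by
        rw [le_principal_iff]
        refine Filter.mem_map.2 (Filter.mem_of_superset univ_mem fun n _ => ?_)
        rw [mem_preimage, mem_closedBall_iff_norm]
        exact norm_eulerCurve_sub_le (h0 n) hM ht le_rfl)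
      exact ⟨y, fun _ => hy⟩
    · exact ⟨0, fun h => absurd h ht⟩
  choose x hx using hex
  refine ⟨x, ?_, ?_⟩
  · refine tendsto_nhds_unique (hx t₀ le_rfl) ?_
    have : (fun n => X n t₀) = fun _ => x₀ := by
      funext n
      simp [hX, eulerCurve, eulerNode]
    rw [this]
    exact tendsto_const_nhds
  · intro s hs
    rw [mem_Ici] at hs
    set c := v s (x s) with hc
    rw [hasDerivWithinAt_iff_isLittleO, Asymptotics.isLittleO_iff]
    intro ε hε
    obtain ⟨δ, hδ, hvδ⟩ := Metric.continuousAt_iff.1 (hv.continuousAt (x := (s, x s))) ε hε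
    have hvδ' : ∀ t y, |t - s| < δ → ‖y - x s‖ < δ → ‖v t y - c‖ ≤ ε := by
      intro t y h1 h2
      have := @hvδ (t, y) (by
        rw [Prod.dist_eq]
        exact max_lt (by simpa [Real.dist_eq] using h1) (by simpa [dist_eq_norm] using h2))
      rw [dist_eq_norm] at this
      exact this.le
    obtain ⟨M, hM⟩ := hM (s + 1)
    have hM0 : 0 ≤ M := (norm_nonneg _).trans (hM s hs (by linarith) 0)
    obtain ⟨ρ, hρ, hρ1, hρδ, hρM⟩ : ∃ ρ > 0, ρ ≤ 1 ∧ ρ < δ / 2 ∧ ρ * M < δ / 2 := by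
      refine ⟨min 1 (δ / (4 * (M + 1))), by positivity, min_le_left _ _, ?_, ?_⟩
      · refine (min_le_right _ _).trans_lt ?_
        rw [div_lt_iff₀ (by positivity)]
        nlinarith
      · calc min 1 (δ / (4 * (M + 1))) * M ≤ δ / (4 * (M + 1)) * M := by
              gcongr
              exact min_le_right _ _
          _ < δ / 2 := by
              rw [div_mul_eq_mul_div, div_lt_iff₀ (by positivity)]
              nlinarith
    -- The base point `s` may be either end of `[a, b]`, which covers both one-sided difference
    -- quotients. The terms in `h n` vanish in the limit.
    have key : ∀ a b, t₀ ≤ a → a ≤ b → b - a < ρ → (s = a ∨ s = b) →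
        ‖x b - x a - (b - a) • c‖ ≤ (b - a) * ε := by
      intro a b ha hab hbρ hsab
      have hbs : b ≤ s + 1 := by rcases hsab with rfl | rfl <;> linarith
      have l1 : Tendsto (fun n => ‖X n b - X n a - (b - a) • c‖) 𝒰
          (𝓝 ‖x b - x a - (b - a) • c‖) :=
        (((hx b (ha.trans hab)).sub (hx a ha)).sub_const _).norm
      have l2 : Tendsto (fun n => (b - a + h n) * ε + h n * ‖c‖) 𝒰 (𝓝 ((b - a) * ε)) := by
        simpa using ((hlim.const_add (b - a)).mul_const ε).add (hlim.mul_const ‖c‖)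
      refine le_of_tendsto_of_tendsto l1 l2 ?_
      have l3 : Tendsto (fun n => b - a + h n) 𝒰 (𝓝 (b - a)) := by
        simpa using hlim.const_add (b - a)
      have l4 : Tendsto (fun n => (b - a + h n) * M + ‖X n s - x s‖) 𝒰 (𝓝 ((b - a) * M)) := by
        simpa using (l3.mul_const M).add ((hx s hs).sub_const (x s)).norm
      have : (b - a) * M ≤ ρ * M := by gcongr
      filter_upwards [l3.eventually_lt_const (show b - a < δ by linarith),
        l4.eventually_lt_const (show (b - a) * M < δ by linarith)] with n hn1 hn2
      exact norm_eulerCurve_sub_sub_le (h0 n) ha hab hsab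
        (fun t ht htb => hM t ht (htb.trans hbs)) hvδ' hn1 hn2
    have hball : ∀ᶠ t in 𝓝[Ici t₀] s, |t - s| < ρ ∧ t₀ ≤ t := by
      filter_upwards [nhdsWithin_le_nhds (Metric.ball_mem_nhds s hρ), self_mem_nhdsWithin]
        with t ht ht'
      exact ⟨by simpa [Real.dist_eq] using ht, ht'⟩
    filter_upwards [hball] with t ⟨ht, ht0⟩
    rw [Real.norm_eq_abs]
    rcases le_total s t with hst | hst
    · rw [abs_of_nonneg (sub_nonneg.2 hst)] at ht ⊢
      rw [mul_comm]
      exact key s t hs hst ht (Or.inl rfl)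
    · rw [abs_of_nonpos (sub_nonpos.2 hst)] at ht ⊢
      have := key t s ht0 hst (by linarith) (Or.inr rfl)
      have e : x t - x s - (t - s) • c = -(x s - x t - (s - t) • c) := by module
      rw [e, norm_neg, mul_comm ε, neg_sub]
      exact this

end Peano

/-! ### Decay for `ż = -z + u` and for cascades of such equations -/

section LinearDecay

variable {E : Type*} [NormedAddCommGroup E] [NormedSpace ℝ E]

/-- Multiplication by `exp (t - a)` leaves an integral of `u`. The rate `1/2` is slower than the
rate `1` of the equation, so an input decaying at rate `1/2` yields an output of the same rate
without polynomial factors, and the estimate can be iterated. -/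
lemma norm_le_of_hasDerivWithinAt_neg_add {z u : ℝ → E} {a b A B : ℝ} (hA : 0 ≤ A) (hB : 0 ≤ B)
    (hz : ∀ t ∈ Icc a b, HasDerivWithinAt z (-z t + u t) (Icc a b) t)
    (hu : ∀ t ∈ Icc a b, ‖u t‖ ≤ A * Real.exp (-(t - a) / 2) + B) {t : ℝ} (ht : t ∈ Icc a b) :
    ‖z t‖ ≤ Real.exp (-(t - a) / 2) * (‖z a‖ + 2 * A) + B := by
  have hexp : ∀ t : ℝ, HasDerivAt (fun t => Real.exp (t - a)) (Real.exp (t - a)) t := fun t => by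
    simpa using ((hasDerivAt_id t).sub_const a).exp
  have hexp2 : ∀ t : ℝ, HasDerivAt (fun t => Real.exp ((t - a) / 2))
      (Real.exp ((t - a) / 2) * (1 / 2)) t := fun t => by
    simpa using (((hasDerivAt_id t).sub_const a).div_const 2).exp
  have hy : ∀ t ∈ Icc a b, HasDerivWithinAt (fun t => Real.exp (t - a) • z t)
      (Real.exp (t - a) • u t) (Icc a b) t := fun t ht => by
    have := (hexp t).hasDerivWithinAt.smul (hz t ht)
    convert! this using 1
    module
  have key := image_norm_le_of_norm_deriv_right_le_deriv_boundary
    (f := fun t => Real.exp (t - a) • z t) (f' := fun t => Real.exp (t - a) • u t) (a := a) (b := b)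
    (B := fun t => ‖z a‖ + 2 * A * Real.exp ((t - a) / 2) + B * Real.exp (t - a))
    (B' := fun t => 2 * A * (Real.exp ((t - a) / 2) * (1 / 2)) + B * Real.exp (t - a))
    (fun t ht => (hy t ht).continuousWithinAt)
    (fun t ht => (hy t (Ico_subset_Icc_self ht)).mono_of_mem_nhdsWithin
      (Icc_mem_nhdsGE_of_mem ht))
    (by
      simp only [sub_self, Real.exp_zero, one_smul, zero_div]
      linarith)
    (fun t => (((hexp2 t).const_mul (2 * A)).const_add ‖z a‖).add ((hexp t).const_mul B))
    (fun t ht => by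
      rw [norm_smul, Real.norm_of_nonneg (Real.exp_pos _).le]
      have h1 := mul_le_mul_of_nonneg_left (hu t (Ico_subset_Icc_self ht)) (Real.exp_pos (t - a)).le
      have h2 : Real.exp (t - a) * Real.exp (-(t - a) / 2) = Real.exp ((t - a) / 2) := by
        rw [← Real.exp_add]
        congr 1
        ring
      calc _ ≤ _ := h1
        _ = A * (Real.exp (t - a) * Real.exp (-(t - a) / 2)) + B * Real.exp (t - a) := by ring
        _ = _ := by rw [h2]; ring) ht
  rw [norm_smul, Real.norm_of_nonneg (Real.exp_pos _).le] at key
  have h3 : Real.exp (t - a) * Real.exp (-(t - a) / 2) = Real.exp ((t - a) / 2) := by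
    rw [← Real.exp_add]
    congr 1
    ring
  have h4 : 1 ≤ Real.exp ((t - a) / 2) := Real.one_le_exp (by linarith [ht.1])
  refine le_of_mul_le_mul_left (key.trans ?_) (Real.exp_pos (t - a))
  calc _ ≤ Real.exp ((t - a) / 2) * ‖z a‖ + 2 * A * Real.exp ((t - a) / 2)
        + B * Real.exp (t - a) := by
        gcongr
        exact le_mul_of_one_le_left (norm_nonneg _) h4
    _ = (Real.exp (t - a) * Real.exp (-(t - a) / 2)) * (‖z a‖ + 2 * A)
        + B * Real.exp (t - a) := by rw [h3]; ring
    _ = _ := by ring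

/-- Every solution of `ż = -z + w` is small once the integrals of `w` over intervals of
length at most one are. -/
lemma norm_le_of_norm_integral_le [CompleteSpace E] {z w : ℝ → E} {a b η : ℝ}
    (hw : ContinuousOn w (Icc a b))
    (hz : ∀ t ∈ Icc a b, HasDerivWithinAt z (-z t + w t) (Icc a b) t)
    (hη : ∀ s s', a ≤ s → s ≤ s' → s' ≤ b → s' ≤ s + 1 → ‖∫ τ in s..s', w τ‖ ≤ η)
    {t : ℝ} (ht : t ∈ Icc a b) :
    ‖z t‖ ≤ Real.exp (-(t - a) / 2) * ‖z a‖ + 8 * η := by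
  have hab : a ≤ b := ht.1.trans ht.2
  have hη0 : 0 ≤ η := (norm_nonneg _).trans (hη a a le_rfl le_rfl hab (by linarith))
  -- A continuous extension to the whole line makes the primitive differentiable at the end points
  -- too.
  set w' : ℝ → E := IccExtend hab ((Icc a b).domRestrict w) with hw'
  have hw'c : Continuous w' := hw.domRestrict.Icc_extend'
  have hww : ∀ t ∈ Icc a b, w' t = w t := fun t ht => by
    rw [hw', IccExtend_of_mem _ _ ht, domRestrict_apply]
  have step : ∀ s t, a ≤ s → s ≤ t → t ≤ b → t ≤ s + 1 →
      ‖z t‖ ≤ Real.exp (-(t - s) / 2) * ‖z s‖ + 2 * η := by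
    intro s t has hst htb hts
    -- `z - W` solves the same equation with input `-W`, which is bounded by `η` although `w` itself
    -- may be large.
    set W : ℝ → E := fun r => ∫ τ in s..r, w' τ with hW
    have hWle : ∀ r ∈ Icc s t, ‖W r‖ ≤ η := fun r hr => by
      have : W r = ∫ τ in s..r, w τ := by
        refine intervalIntegral.integral_congr fun τ hτ => hww τ ?_
        rw [uIcc_of_le hr.1] at hτ
        exact ⟨has.trans hτ.1, hτ.2.trans (hr.2.trans htb)⟩
      rw [this]
      exact hη s r has hr.1 (hr.2.trans htb) (hr.2.trans hts)
    have hder : ∀ r ∈ Icc s t, HasDerivWithinAt (fun r => z r - W r)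
        (-(z r - W r) + -W r) (Icc s t) r := fun r hr => by
      have hr' : r ∈ Icc a b := ⟨has.trans hr.1, hr.2.trans htb⟩
      have h1 := (hz r hr').mono (Icc_subset_Icc has htb)
      have h2 : HasDerivAt W (w' r) r := hw'c.integral_hasStrictDerivAt s r |>.hasDerivAt
      rw [hww r hr'] at h2
      convert! h1.sub h2.hasDerivWithinAt using 1
      abel
    have h := norm_le_of_hasDerivWithinAt_neg_add (A := 0) (B := η) le_rfl hη0 hder
      (fun r hr => by simpa using hWle r hr) (right_mem_Icc.2 hst)
    have hWs : W s = 0 := intervalIntegral.integral_same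
    rw [hWs, sub_zero, mul_zero, add_zero] at h
    have h2 := hWle t (right_mem_Icc.2 hst)
    have h3 := norm_add_le (z t - W t) (W t)
    rw [sub_add_cancel] at h3
    linarith
  have hhalf : Real.exp (-1 / 2) ≤ 2 / 3 := by
    have h1 : (3 / 2 : ℝ) ≤ Real.exp (1 / 2) := by
      have := Real.add_one_le_exp (1 / 2 : ℝ)
      linarith
    rw [show (-1 / 2 : ℝ) = -(1 / 2) by ring, Real.exp_neg]
    exact (inv_anti₀ (by norm_num) h1).trans (by norm_num)
  -- The constant `6` is reproduced by a unit step, since `(2/3) * 6 + 2 = 6`. The last partial step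
  -- adds `2`, hence the final `8`.
  have hint : ∀ k : ℕ, a + k ≤ b → ‖z (a + k)‖ ≤ Real.exp (-k / 2) * ‖z a‖ + 6 * η := by
    intro k
    induction k with
    | zero =>
      intro _
      simp
      positivity
    | succ k ih =>
      intro hk
      push_cast at hk ⊢
      have h1 := ih (by linarith)
      have h2 := step (a + k) (a + (k + 1)) (by linarith [k.cast_nonneg (α := ℝ)]) (by linarith) hk
        (by linarith)
      have e1 : -(a + ((k : ℝ) + 1) - (a + k)) / 2 = -1 / 2 := by ring
      have e2 : Real.exp (-((k : ℝ) + 1) / 2) = Real.exp (-1 / 2) * Real.exp (-k / 2) := by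
        rw [← Real.exp_add]
        congr 1
        ring
      rw [e1] at h2
      rw [e2]
      have h3 := mul_le_mul_of_nonneg_left h1 (Real.exp_pos (-1 / 2)).le
      have h4 := mul_le_mul_of_nonneg_right hhalf hη0
      nlinarith
  set k := ⌊t - a⌋₊ with hk
  have hk1 : (k : ℝ) ≤ t - a := Nat.floor_le (by linarith [ht.1])
  have hk2 : t - a < k + 1 := Nat.lt_floor_add_one _
  have h1 := hint k (by linarith [ht.2])
  have h2 := step (a + k) t (by linarith [k.cast_nonneg (α := ℝ)]) (by linarith) ht.2 (by linarith)
  have e : Real.exp (-(t - a) / 2) = Real.exp (-(t - (a + k)) / 2) * Real.exp (-k / 2) := by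
    rw [← Real.exp_add]
    congr 1
    ring
  have h5 : Real.exp (-(t - (a + k)) / 2) ≤ 1 := Real.exp_le_one_iff.2 (by linarith)
  rw [e]
  have h3 := mul_le_mul_of_nonneg_left h1 (Real.exp_pos (-(t - (a + k)) / 2)).le
  have h4 := mul_le_mul_of_nonneg_right h5 hη0
  nlinarith

/-- Induction upwards from the last equation, the only one driven by `w`. Each level at most triples
the transient, as `1 + 2 * 3 ^ k ≤ 3 ^ (k + 1)`, while the constant error `8 * η` passes through
with gain one. -/
lemma cascade_norm_le [CompleteSpace E] {n : ℕ} {z : ℕ → ℝ → E} {w : ℝ → E} {a b η N : ℝ}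
    (hab : a ≤ b) (hw : ContinuousOn w (Icc a b))
    (hz : ∀ i < n, ∀ t ∈ Icc a b, HasDerivWithinAt (z i)
      (-z i t + z (i + 1) t + if i + 1 = n then w t else 0) (Icc a b) t)
    (hzn : ∀ t, z n t = 0) (hN : ∀ i < n, ‖z i a‖ ≤ N)
    (hη : ∀ s s', a ≤ s → s ≤ s' → s' ≤ b → s' ≤ s + 1 → ‖∫ τ in s..s', w τ‖ ≤ η)
    (k : ℕ) : ∀ i, i + k + 1 = n → ∀ t ∈ Icc a b,
      ‖z i t‖ ≤ 3 ^ k * N * Real.exp (-(t - a) / 2) + 8 * η := by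
  have hη0 : 0 ≤ η := (norm_nonneg _).trans (hη a a le_rfl le_rfl hab (by linarith))
  induction k with
  | zero =>
    intro i hi t ht
    have hin : i + 1 = n := by omega
    have h := norm_le_of_norm_integral_le hw (z := z i) (fun t ht => by
      simpa [hin, hzn] using hz i (by omega) t ht) hη ht
    have := mul_le_mul_of_nonneg_left (hN i (by omega)) (Real.exp_pos (-(t - a) / 2)).le
    linarith
  | succ k ih =>
    intro i hi t ht
    have hN0 : 0 ≤ N := (norm_nonneg _).trans (hN i (by omega))
    have h := norm_le_of_hasDerivWithinAt_neg_add (z := z i) (u := z (i + 1)) (A := 3 ^ k * N)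
      (B := 8 * η) (by positivity) (by positivity) (fun t ht => by
      simpa [show i + 1 ≠ n by omega] using hz i (by omega) t ht) (ih (i + 1) (by omega)) ht
    refine h.trans ?_
    have h1 := hN i (by omega)
    have h2 : (1 : ℝ) ≤ 3 ^ k := one_le_pow₀ (by norm_num)
    have h3 : ‖z i a‖ + 2 * (3 ^ k * N) ≤ 3 ^ (k + 1) * N := by
      rw [pow_succ]
      nlinarith
    have := mul_le_mul_of_nonneg_left h3 (Real.exp_pos (-(t - a) / 2)).le
    linarith

end LinearDecay

/-! ### The chain of integrators and its cascade coordinates -/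

section Chain

/-- Pascal's rule: with `S` the shift of sequences, `(S + 1)ⁱ⁺¹ = S (S + 1)ⁱ + (S + 1)ⁱ` at index
`0`. -/
lemma sum_choose_succ_smul {M : Type*} [AddCommGroup M] [Module ℝ M] (c : ℕ → M) (i : ℕ) :
    ∑ j ∈ Finset.range (i + 2), ((i + 1).choose j : ℝ) • c j
      = ∑ j ∈ Finset.range (i + 1), (i.choose j : ℝ) • c (j + 1)
        + ∑ j ∈ Finset.range (i + 1), (i.choose j : ℝ) • c j := by
  rw [Finset.sum_range_succ']
  have h : ∑ j ∈ Finset.range (i + 1), (i.choose j : ℝ) • c j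
      = ∑ j ∈ Finset.range (i + 1), (i.choose (j + 1) : ℝ) • c (j + 1) + c 0 := by
    have h1 := Finset.sum_range_succ (fun j => (i.choose j : ℝ) • c j) (i + 1)
    rw [Finset.sum_range_succ'] at h1
    simpa using h1.symm
  rw [h]
  simp only [Nat.choose_succ_succ, Nat.cast_add, add_smul, Finset.sum_add_distrib]
  simp
  abel

variable {m n : ℕ}

/-- The gain `X ↦ -∑ j < n, (n choose j) Xⱼ`, which places all the poles of the chain of
integrators at `-1`. -/
def chainGain (m n : ℕ) : State m n →L[ℝ] Input m :=
  -∑ j : Fin n, (n.choose j : ℝ) • ContinuousLinearMap.proj j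

/-- The `j`-th column of the state, continued by the value of the gain for `j = n`. -/
def chainCoord (m n j : ℕ) : State m n →L[ℝ] Input m :=
  if h : j < n then ContinuousLinearMap.proj ⟨j, h⟩ else chainGain m n

/-- The value `(d/dt + 1)ⁱ X₀` along the chain of integrators. -/
def chainCascade (m n i : ℕ) : State m n →L[ℝ] Input m :=
  ∑ j ∈ Finset.range (i + 1), (i.choose j : ℝ) • chainCoord m n j

/-- The chain of integrators closed by the gain, with an additive input `w`. -/
def chainField (X : State m n) (w : Input m) : State m n :=
  fun i => if h : (i : ℕ) + 1 < n then X ⟨(i : ℕ) + 1, h⟩ else chainGain m n X + w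

/-- The gain is exactly minus the lower-order terms of `(S + 1)ⁿ`, so the cascade terminates. -/
lemma chainCascade_self (X : State m n) : chainCascade m n n X = 0 := by
  rw [chainCascade, Finset.sum_range_succ, Finset.sum_range]
  have h : ∀ j : Fin n, chainCoord m n j = ContinuousLinearMap.proj j := fun j => by
    simp [chainCoord]
  have h' : chainCoord m n n = chainGain m n := by simp [chainCoord]
  simp only [h, h', chainGain, Nat.choose_self, Nat.cast_one, one_smul, add_neg_cancel]
  rfl

lemma chainCoord_chainField {j : ℕ} (hj : j < n) (X : State m n) (w : Input m) :
    chainCoord m n j (chainField X w)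
      = chainCoord m n (j + 1) X + if j + 1 = n then w else 0 := by
  rcases Nat.lt_or_ge (j + 1) n with h | h
  · simp [chainCoord, chainField, hj, h, h.ne]
  · have : j + 1 = n := by omega
    simp [chainCoord, chainField, hj, this]

/-- This is `d/dt (d/dt + 1)ⁱ = (d/dt + 1)ⁱ⁺¹ - (d/dt + 1)ⁱ`. The input reaches only the level `i =
n - 1`, through the leading binomial coefficient `1`. -/
lemma chainCascade_chainField {i : ℕ} (hi : i < n) (X : State m n) (w : Input m) :
    chainCascade m n i (chainField X w)
      = -chainCascade m n i X + chainCascade m n (i + 1) X + if i + 1 = n then w else 0 := by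
  have h := sum_choose_succ_smul (fun j => chainCoord m n j X) i
  simp only [chainCascade, sum_apply, smul_apply]
  rw [h, neg_add_cancel_comm_assoc]
  have h1 : ∀ j ∈ Finset.range (i + 1), (i.choose j : ℝ) • chainCoord m n j (chainField X w)
      = (i.choose j : ℝ) • chainCoord m n (j + 1) X
        + (i.choose j : ℝ) • if j + 1 = n then w else 0 := fun j hj => by
    rw [Finset.mem_range] at hj
    rw [chainCoord_chainField (by omega), smul_add]
  have h2 : ∑ j ∈ Finset.range (i + 1), (i.choose j : ℝ) • (if j + 1 = n then w else 0)
      = if i + 1 = n then w else 0 := by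
    rw [Finset.sum_range_succ, Finset.sum_eq_zero]
    · simp
    · intro j hj
      rw [Finset.mem_range] at hj
      simp [show j + 1 ≠ n by omega]
  rw [Finset.sum_congr rfl h1, Finset.sum_add_distrib, h2]

/-- The map `X ↦ (chainCascade i X)ᵢ`. -/
def chainTransform (m n : ℕ) : State m n →L[ℝ] State m n :=
  ContinuousLinearMap.pi fun i : Fin n => chainCascade m n i

/-- The transform is triangular with unit diagonal. -/
lemma chainTransform_ker : (chainTransform m n).ker = ⊥ := by
  rw [LinearMap.ker_eq_bot']
  intro X hX
  have h : ∀ i : ℕ, ∀ hi : i < n, X ⟨i, hi⟩ = 0 := by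
    intro i
    induction i using Nat.strong_induction_on with
    | _ i ih =>
      intro hi
      have h1 : chainCascade m n i X = 0 := congrFun hX ⟨i, hi⟩
      simp only [chainCascade, sum_apply, smul_apply] at h1
      rw [Finset.sum_range_succ, Finset.sum_eq_zero] at h1
      · simpa [chainCoord, hi] using h1
      · intro j hj
        rw [Finset.mem_range] at hj
        simp [chainCoord, hj.trans hi, ih j hj (hj.trans hi)]
  funext i
  exact h i i.2

/-- The cascade bound is carried back through the injective linear transform. As `w` is an arbitrary
function of time, it may be a state-dependent perturbation evaluated along the solution itself. -/
theorem exists_chain_decay (m n : ℕ) : ∃ C > 0, ∀ {a b η : ℝ} {x : ℝ → State m n}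
    {w : ℝ → Input m}, ContinuousOn w (Icc a b) →
    (∀ t ∈ Icc a b, HasDerivWithinAt x (chainField (x t) (w t)) (Icc a b) t) →
    (∀ s s', a ≤ s → s ≤ s' → s' ≤ b → s' ≤ s + 1 → ‖∫ τ in s..s', w τ‖ ≤ η) →
    ∀ t ∈ Icc a b, ‖x t‖ ≤ C * (Real.exp (-(t - a) / 2) * ‖x a‖ + η) := by
  obtain ⟨K, hK0, hK⟩ := (chainTransform m n : State m n →ₗ[ℝ] State m n).exists_antilipschitzWith
    chainTransform_ker
  have hK' : ∀ X, ‖X‖ ≤ K * ‖chainTransform m n X‖ := fun X => by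
    simpa using hK.le_mul_norm (map_zero _) X
  set S := ‖chainTransform m n‖ with hS
  refine ⟨K * (3 ^ n * S + 8), by positivity, ?_⟩
  intro a b η x w hw hx hη t ht
  have hab := ht.1.trans ht.2
  have hη0 : 0 ≤ η := (norm_nonneg _).trans (hη a a le_rfl le_rfl hab (by linarith))
  have hbound : ‖chainTransform m n (x t)‖
      ≤ 3 ^ n * (S * ‖x a‖) * Real.exp (-(t - a) / 2) + 8 * η := by
    refine (pi_norm_le_iff_of_nonneg (by positivity)).2 fun i => ?_
    have h := cascade_norm_le (z := fun i t => chainCascade m n i (x t)) (n := n) (N := S * ‖x a‖)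
      hab hw (fun i hi t ht => by
        rw [← chainCascade_chainField hi]
        exact (chainCascade m n i).hasFDerivAt.comp_hasDerivWithinAt t (hx t ht))
      (fun t => chainCascade_self _)
      (fun i hi => (norm_le_pi_norm (chainTransform m n (x a)) ⟨i, hi⟩).trans
        ((chainTransform m n).le_opNorm _)) hη (n - 1 - i) i (by omega) t ht
    refine h.trans ?_
    gcongr
    · norm_num
    · omega
  refine (hK' _).trans ?_
  rw [mul_assoc]
  refine mul_le_mul_of_nonneg_left (hbound.trans ?_) K.2
  have := mul_nonneg (mul_nonneg (norm_nonneg (x a)) (Real.exp_pos (-(t - a) / 2)).le)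
    (show (0 : ℝ) ≤ 8 by norm_num)
  have : 0 ≤ 3 ^ n * S * η := by positivity
  linarith

end Chain

/-! ### Integrals of diminishing functions with slowly varying weights -/

section Diminishing

variable {E : Type*} [NormedAddCommGroup E] [NormedSpace ℝ E]

lemma Diminishing.exists_norm_integral_le {h : ℝ → E} (hh : Diminishing h) {η : ℝ} (hη : 0 < η) :
    ∃ a ≥ 0, ∀ s ≥ a, ∀ s', s ≤ s' → s' ≤ s + 1 → ‖∫ τ in s..s', h τ‖ ≤ η := by
  obtain ⟨a, ha⟩ := eventually_atTop.1 (hh.2.eventually_lt_const hη)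
  refine ⟨max a 0, le_max_right _ _, fun s hs s' hss' hs' => ?_⟩
  have hs0 : 0 ≤ s := (le_max_right _ _).trans hs
  have hint : ContinuousOn (fun r => ∫ τ in s..r, h τ) (Icc s (s + 1)) := by
    have hi : MeasureTheory.IntegrableOn h (uIcc s (s + 1)) := by
      rw [uIcc_of_le (by linarith)]
      exact (hh.1.mono fun t ht => hs0.trans ht.1).integrableOn_Icc
    have := intervalIntegral.continuousOn_primitive_interval hi
    rwa [uIcc_of_le (by linarith)] at this
  obtain ⟨C, hC⟩ := isCompact_Icc.exists_bound_of_continuousOn hint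
  -- A supremum dominates its terms only when the family is bounded, which compactness supplies.
  have hbdd : BddAbove (range fun l : Icc (0 : ℝ) 1 => ‖∫ τ in s..(s + (l : ℝ)), h τ‖) := by
    refine ⟨C, ?_⟩
    rintro _ ⟨l, rfl⟩
    exact hC _ ⟨by linarith [l.2.1], by linarith [l.2.2]⟩
  have h1 := le_ciSup hbdd ⟨s' - s, by linarith, by linarith⟩
  simp only [add_sub_cancel] at h1
  exact h1.trans (ha s ((le_max_left _ _).trans hs)).le

lemma diminishing_of_norm_integral_le {h : ℝ → E} (hh : ContinuousOn h (Ici 0))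
    (H : ∀ η > 0, ∃ a, ∀ s ≥ a, ∀ s', s ≤ s' → s' ≤ s + 1 → ‖∫ τ in s..s', h τ‖ ≤ η) :
    Diminishing h := by
  refine ⟨hh, Metric.tendsto_atTop.2 fun ε hε => ?_⟩
  obtain ⟨a, ha⟩ := H (ε / 2) (by positivity)
  refine ⟨a, fun s hs => ?_⟩
  rw [Real.dist_eq, sub_zero, abs_of_nonneg (Real.iSup_nonneg fun l => norm_nonneg _)]
  refine lt_of_le_of_lt (ciSup_le fun l => ?_) (half_lt_self hε)
  exact ha s hs _ (by linarith [l.2.1]) (by linarith [l.2.2])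

/-- An integral of `k • h` is controlled by the integrals of `h` over short intervals and the
modulus of continuity of `k`. -/
lemma norm_integral_smul_le {h : ℝ → E} {k : ℝ → ℝ} {C κ η ω d : ℝ} (hd : 0 ≤ d) (N : ℕ) :
    ∀ {s s' : ℝ}, s ≤ s' → s' ≤ s + N * d → ContinuousOn h (Icc s s') →
    ContinuousOn k (Icc s s') → (∀ t ∈ Icc s s', ‖h t‖ ≤ C) → (∀ t ∈ Icc s s', |k t| ≤ κ) →
    (∀ u ∈ Icc s s', ∀ v ∈ Icc s s', |u - v| ≤ d → |k u - k v| ≤ ω) →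
    (∀ u v, s ≤ u → u ≤ v → v ≤ s' → ‖∫ τ in u..v, h τ‖ ≤ η) →
    ‖∫ τ in s..s', k τ • h τ‖ ≤ N * (κ * η) + C * ω * (s' - s) := by
  induction N with
  | zero =>
    intro s s' hss' hs' _ _ _ _ _ _
    have : s = s' := le_antisymm hss' (by simpa using hs')
    simp [this]
  | succ N ih =>
    intro s s' hss' hs' hh hk hC hκ hω hη
    set u := min (s + d) s' with hu
    have hsu : s ≤ u := le_min (by linarith) hss'
    have hus' : u ≤ s' := min_le_right _ _
    have hud : u - s ≤ d := by linarith [min_le_left (s + d) s']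
    have hs'' : s' ≤ u + N * d := by
      push_cast at hs'
      rw [hu, min_add]
      exact le_min (by linarith) (le_add_of_nonneg_right (by positivity))
    have sub1 : Icc s u ⊆ Icc s s' := Icc_subset_Icc le_rfl hus'
    have sub2 : Icc u s' ⊆ Icc s s' := Icc_subset_Icc hsu le_rfl
    have hi1 : IntervalIntegrable (fun τ => k τ • h τ) MeasureTheory.volume s u :=
      ((hk.smul hh).mono (by rwa [uIcc_of_le hsu])).intervalIntegrable
    have hi2 : IntervalIntegrable (fun τ => k τ • h τ) MeasureTheory.volume u s' :=
      ((hk.smul hh).mono (by rwa [uIcc_of_le hus'])).intervalIntegrable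
    have hih : IntervalIntegrable h MeasureTheory.volume s u :=
      (hh.mono (by rwa [uIcc_of_le hsu])).intervalIntegrable
    have h2 := ih hus' hs'' (hh.mono sub2) (hk.mono sub2) (fun t ht => hC t (sub2 ht))
      (fun t ht => hκ t (sub2 ht)) (fun a ha b hb => hω a (sub2 ha) b (sub2 hb))
      (fun a b ha hab hb => hη a b (hsu.trans ha) hab hb)
    have h1 : ‖∫ τ in s..u, k τ • h τ‖ ≤ κ * η + C * ω * (u - s) := by
      -- Freeze the weight at `s`: the frozen part sees only the integral of `h`, and the remainder
      -- sees only the oscillation of `k` over a time at most `d`.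
      have e : ∫ τ in s..u, k τ • h τ
          = k s • (∫ τ in s..u, h τ) + ∫ τ in s..u, (k τ • h τ - k s • h τ) := by
        have hi3 : IntervalIntegrable (fun τ => k s • h τ) MeasureTheory.volume s u :=
          hih.smul (k s)
        rw [intervalIntegral.integral_sub hi1 hi3, intervalIntegral.integral_smul]
        abel
      rw [e]
      have hsm : s ∈ Icc s s' := left_mem_Icc.2 hss'
      refine (norm_add_le _ _).trans (add_le_add ?_ ?_)
      · rw [norm_smul, Real.norm_eq_abs]
        exact mul_le_mul (hκ s hsm) (hη s u le_rfl hsu hus') (norm_nonneg _)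
          ((abs_nonneg _).trans (hκ s hsm))
      · have := intervalIntegral.norm_integral_le_of_norm_le_const
          (f := fun τ => k τ • h τ - k s • h τ) (a := s) (b := u) (C := C * ω) (fun τ hτ => by
            rw [uIoc_of_le hsu] at hτ
            have hτ' : τ ∈ Icc s s' := ⟨hτ.1.le, hτ.2.trans hus'⟩
            rw [← sub_smul, norm_smul, mul_comm, Real.norm_eq_abs]
            refine mul_le_mul (hC τ hτ') (hω τ hτ' s hsm ?_) (abs_nonneg _)
              ((norm_nonneg _).trans (hC τ hτ'))
            rw [abs_of_nonneg (by linarith [hτ.1])]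
            linarith [hτ.2])
        rwa [abs_of_nonneg (by linarith)] at this
    rw [← intervalIntegral.integral_add_adjacent_intervals hi1 hi2]
    refine (norm_add_le _ _).trans ((add_le_add h1 h2).trans (le_of_eq ?_))
    push_cast
    ring

/-- A bounded diminishing function stays diminishing after multiplication by a function of a
uniformly bounded and uniformly Lipschitz curve. -/
lemma Diminishing.exists_norm_integral_comp_smul_le {V : Type*} [NormedAddCommGroup V]
    [NormedSpace ℝ V] [FiniteDimensional ℝ V] {h : ℝ → E} (hh : Diminishing h)
    {C : ℝ} (hC : ∀ t ≥ 0, ‖h t‖ ≤ C) {κ : V → ℝ} (hκ : Continuous κ) (r L : ℝ) {η : ℝ}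
    (hη : 0 < η) :
    ∃ a ≥ 0, ∀ s ≥ a, ∀ s', s ≤ s' → s' ≤ s + 1 → ∀ x : ℝ → V, ContinuousOn x (Icc s s') →
      (∀ t ∈ Icc s s', ‖x t‖ ≤ r) →
      (∀ u ∈ Icc s s', ∀ v ∈ Icc s s', ‖x u - x v‖ ≤ L * |u - v|) →
      ‖∫ τ in s..s', κ (x τ) • h τ‖ ≤ η := by
  have hC0 : 0 ≤ C := (norm_nonneg _).trans (hC 0 le_rfl)
  have hcomp : IsCompact (Metric.closedBall (0 : V) r) := isCompact_closedBall _ _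
  obtain ⟨B, hB⟩ := hcomp.exists_bound_of_continuousOn hκ.continuousOn
  obtain ⟨δ, hδ, hu⟩ := Metric.uniformContinuousOn_iff.1
    (hcomp.uniformContinuousOn_of_continuous hκ.continuousOn) (η / (2 * (C + 1))) (by positivity)
  -- A curve with Lipschitz constant `L` moves by less than `δ` in time `d`. The number `N` of
  -- pieces covering unit length is fixed before the starting time `a` is chosen.
  set d := δ / (2 * (|L| + 1)) with hd
  have hd0 : 0 < d := by positivity
  obtain ⟨N, hN⟩ := exists_nat_ge (1 / d)
  have hN1 : 1 ≤ N * d := by rwa [div_le_iff₀ hd0] at hN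
  obtain ⟨a, ha0, ha⟩ := hh.exists_norm_integral_le (η := η / (2 * (N * |B| + 1))) (by positivity)
  refine ⟨a, ha0, fun s hs s' hss' hs' x hx hr hL => ?_⟩
  have hmem : ∀ t ∈ Icc s s', x t ∈ Metric.closedBall (0 : V) r := fun t ht => by
    simpa using hr t ht
  have hs0 : 0 ≤ s := ha0.trans hs
  have h1 := norm_integral_smul_le (h := h) (k := fun τ => κ (x τ)) (C := C) (κ := |B|)
    (η := η / (2 * (N * |B| + 1))) (ω := η / (2 * (C + 1))) hd0.le N hss' (by linarith)
    (hh.1.mono fun t ht => hs0.trans ht.1) (hκ.comp_continuousOn hx)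
    (fun t ht => hC t (hs0.trans ht.1))
    (fun t ht => (hB _ (hmem t ht)).trans (le_abs_self B))
    (fun u hu' v hv huv => by
      have h2 : ‖x u - x v‖ < δ := by
        refine (hL u hu' v hv).trans_lt ?_
        calc L * |u - v| ≤ |L| * d := mul_le_mul (le_abs_self L) huv (abs_nonneg _) (abs_nonneg _)
          _ < δ := by
            rw [hd, mul_div_assoc', div_lt_iff₀ (by positivity)]
            nlinarith [abs_nonneg L]
      have := hu _ (hmem u hu') _ (hmem v hv) (by rwa [dist_eq_norm])
      rw [Real.dist_eq] at this
      exact this.le)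
    (fun u v hsu huv hv => ha u (hs.trans hsu) v huv (by linarith))
  refine h1.trans ?_
  have h2 : N * (|B| * (η / (2 * (N * |B| + 1)))) ≤ η / 2 := by
    rw [← mul_assoc, mul_div_assoc', div_le_div_iff₀ (by positivity) (by positivity)]
    nlinarith
  have h3 : C * (η / (2 * (C + 1))) ≤ η / 2 := by
    rw [mul_div_assoc', div_le_div_iff₀ (by positivity) (by positivity)]
    nlinarith
  have h4 : C * (η / (2 * (C + 1))) * (s' - s) ≤ C * (η / (2 * (C + 1))) :=
    mul_le_of_le_one_right (by positivity) (by linarith)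
  linarith

end Diminishing

/-! ### Perturbations along confined solutions -/

section Perturbation

variable {m n : ℕ} {D : ℝ → Matrix (Fin m) (Fin m) ℝ} {K : State m n → Input m}

lemma perturbation_eq_sum (D : ℝ → Matrix (Fin m) (Fin m) ℝ) (K : State m n → Input m) (t : ℝ)
    (X : State m n) : perturbation D K t X = ∑ j, K X j • column D j t := by
  ext i
  simp [perturbation, column, Matrix.mulVec, dotProduct, mul_comm]

lemma continuousOn_perturbation (h : AdmissiblePerturbation D K) :
    ContinuousOn (fun q : ℝ × State m n => perturbation D K q.1 q.2) (Ici 0 ×ˢ univ) := by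
  simp only [perturbation_eq_sum]
  refine continuousOn_finsetSum _ fun j _ => ContinuousOn.fun_smul ?_ ?_
  · have := h.1
    fun_prop
  · exact (h.2.1 j).1.comp continuousOn_fst fun q hq => hq.1

lemma norm_chainField_le (X : State m n) (w : Input m) :
    ‖chainField X w‖ ≤ (1 + ‖chainGain m n‖) * ‖X‖ + ‖w‖ := by
  refine (pi_norm_le_iff_of_nonneg (by positivity)).2 fun i => ?_
  have h1 := (chainGain m n).le_opNorm X
  rw [chainField]
  split_ifs with h
  · have h2 := norm_le_pi_norm X ⟨i + 1, h⟩
    have := norm_nonneg w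
    have := mul_nonneg (norm_nonneg (chainGain m n)) (norm_nonneg X)
    linarith
  · refine (norm_add_le _ _).trans ?_
    linarith [norm_nonneg X]

/-- Along the solutions of the perturbed chain that stay in a ball, an admissible perturbation
has uniformly small integrals over intervals of length at most one. -/
theorem AdmissiblePerturbation.exists_norm_integral_le (h : AdmissiblePerturbation D K) (r : ℝ)
    {η : ℝ} (hη : 0 < η) :
    ∃ a ≥ 0, ∀ s ≥ a, ∀ s', s ≤ s' → s' ≤ s + 1 → ∀ x : ℝ → State m n,
      (∀ t ∈ Icc s s', ‖x t‖ ≤ r) →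
      (∀ t ∈ Icc s s', HasDerivWithinAt x (chainField (x t) (perturbation D K t (x t)))
        (Icc s s') t) →
      ‖∫ τ in s..s', perturbation D K τ (x τ)‖ ≤ η := by
  obtain ⟨hK, hD, hbdd⟩ := h
  have hKj : ∀ j, Continuous fun X => K X j := fun j => by fun_prop
  -- A speed bound for solutions in the ball, which requires bounded columns. For constant `K` it is
  -- neither available nor needed, because the weights `K (x t) j` are then constant.
  obtain ⟨L, hL⟩ : ∃ L, (¬ ∃ c, ∀ X, K X = c) → ∀ t ≥ 0, ∀ X : State m n, ‖X‖ ≤ r →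
      ‖chainField X (perturbation D K t X)‖ ≤ L := by
    by_cases hc : ∃ c, ∀ X, K X = c
    · exact ⟨0, fun h => absurd hc h⟩
    choose C hC using hbdd hc
    have hcomp : IsCompact (Metric.closedBall (0 : State m n) r) := isCompact_closedBall _ _
    obtain ⟨B, hB⟩ := hcomp.exists_bound_of_continuousOn hK.continuousOn
    refine ⟨(1 + ‖chainGain m n‖) * r + ∑ j, B * C j, fun _ t ht X hX => ?_⟩
    refine (norm_chainField_le X _).trans (add_le_add (by gcongr) ?_)
    rw [perturbation_eq_sum]
    refine (norm_sum_le _ _).trans (Finset.sum_le_sum fun j _ => ?_)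
    rw [norm_smul]
    have hBX := hB X (by simpa using hX)
    exact mul_le_mul ((PiLp.norm_apply_le (K X) j).trans hBX) (hC j t ht) (norm_nonneg _)
      ((norm_nonneg _).trans hBX)
  have hcol : ∀ j : Fin m, ∃ a ≥ 0, ∀ s ≥ a, ∀ s', s ≤ s' → s' ≤ s + 1 → ∀ x : ℝ → State m n,
      (∀ t ∈ Icc s s', ‖x t‖ ≤ r) →
      (∀ t ∈ Icc s s', HasDerivWithinAt x (chainField (x t) (perturbation D K t (x t)))
        (Icc s s') t) →
      ‖∫ τ in s..s', K (x τ) j • column D j τ‖ ≤ η / (m + 1) := by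
    intro j
    by_cases hc : ∃ c, ∀ X, K X = c
    · obtain ⟨c, hc⟩ := hc
      obtain ⟨a, ha0, ha⟩ := (hD j).exists_norm_integral_le
        (η := η / (m + 1) / (|c j| + 1)) (by positivity)
      refine ⟨a, ha0, fun s hs s' hss' hs' x _ _ => ?_⟩
      simp only [hc]
      rw [intervalIntegral.integral_smul, norm_smul, Real.norm_eq_abs]
      calc _ ≤ |c j| * (η / (m + 1) / (|c j| + 1)) := by
            gcongr
            exact ha s hs s' hss' hs'
        _ ≤ η / (m + 1) := by
            rw [mul_div_assoc', div_le_iff₀ (by positivity), mul_comm]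
            gcongr
            linarith
    · obtain ⟨C, hC⟩ := hbdd hc j
      obtain ⟨a, ha0, ha⟩ := (hD j).exists_norm_integral_comp_smul_le hC (hKj j) r L
        (η := η / (m + 1)) (by positivity)
      refine ⟨a, ha0, fun s hs s' hss' hs' x hr hx => ha s hs s' hss' hs' x
        (fun t ht => (hx t ht).continuousWithinAt) hr fun u hu v hv => ?_⟩
      exact (convex_Icc s s').norm_image_sub_le_of_norm_hasDerivWithin_le hx
        (fun t ht => hL hc t (ha0.trans (hs.trans ht.1)) _ (hr t ht)) hv hu
  choose a ha0 ha using hcol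
  refine ⟨∑ j, a j, Finset.sum_nonneg fun j _ => ha0 j, fun s hs s' hss' hs' x hr hx => ?_⟩
  have has : ∀ j, a j ≤ s := fun j =>
    (Finset.single_le_sum (fun i _ => ha0 i) (Finset.mem_univ j)).trans hs
  have hs0 : 0 ≤ s := (Finset.sum_nonneg fun j _ => ha0 j).trans hs
  have hxc : ContinuousOn x (Icc s s') := fun t ht => (hx t ht).continuousWithinAt
  simp only [perturbation_eq_sum] at hx ⊢
  rw [intervalIntegral.integral_finsetSum]
  · refine (norm_sum_le _ _).trans ((Finset.sum_le_sum fun j _ => ha j s (has j) s' hss' hs' x hr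
      (by simpa only [perturbation_eq_sum] using hx)).trans ?_)
    rw [Finset.sum_const, Finset.card_univ, Fintype.card_fin, nsmul_eq_mul, mul_div_assoc',
      div_le_iff₀ (by positivity)]
    linarith
  · intro j _
    refine ContinuousOn.intervalIntegrable ?_
    rw [uIcc_of_le hss']
    exact ((hKj j).comp_continuousOn hxc).smul ((hD j).1.mono fun t ht => hs0.trans ht.1)

end Perturbation

/-! ### Continuation of solutions -/

section Extension

variable {E : Type*} [NormedAddCommGroup E] [NormedSpace ℝ E] [FiniteDimensional ℝ E]

/-- Solutions of a field that is bounded on compact time intervals can be continued past the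
right end point of their interval of definition. -/
theorem exists_solution_extension {v : ℝ → E → E}
    (hv : Continuous fun q : ℝ × E => v q.1 q.2) {t₀ T : ℝ} (hT : t₀ < T)
    (hM : ∀ s T, ∃ M, ∀ t, s ≤ t → t ≤ T → ∀ y, ‖v t y‖ ≤ M) {x : ℝ → E}
    (hx : ∀ t ∈ Ico t₀ T, HasDerivWithinAt x (v t (x t)) (Ico t₀ T) t) :
    ∃ y, EqOn x y (Ico t₀ T) ∧ ∀ t ∈ Ici t₀, HasDerivWithinAt y (v t (y t)) (Ici t₀) t := by
  obtain ⟨M, hMT⟩ := hM t₀ T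
  have hLip : LipschitzOnWith (Real.toNNReal M) x (Ico t₀ T) :=
    (convex_Ico t₀ T).lipschitzOnWith_of_nnnorm_hasDerivWithin_le hx fun t ht => by
      have := hMT t ht.1 ht.2.le (x t)
      rw [← NNReal.coe_le_coe, coe_nnnorm]
      exact this.trans (Real.le_coe_toNNReal M)
  -- Bounded speed makes `x` Lipschitz, and the Lipschitz extension supplies its limit at `T`, from
  -- which a new solution is started.
  obtain ⟨g, hg, hxg⟩ := hLip.extend_finite_dimension
  obtain ⟨z, hzT, hz⟩ := exists_solution_of_continuous hv T (g T) (hM T)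
  set y : ℝ → E := fun t => if t < T then x t else z t with hy
  have hyl : ∀ t, t < T → y t = x t := fun t ht => by simp [hy, ht]
  have hyr : ∀ t, T ≤ t → y t = z t := fun t ht => by simp [hy, ht.not_gt]
  refine ⟨y, fun t ht => (hyl t ht.2).symm, fun t ht => ?_⟩
  rw [mem_Ici] at ht
  rcases lt_trichotomy t T with htT | rfl | htT
  · have h1 : HasDerivWithinAt x (v t (x t)) (Ici t₀) t :=
      (hx t ⟨ht, htT⟩).mono_of_mem_nhdsWithin (by
        rw [← Ici_inter_Iio]
        exact inter_mem self_mem_nhdsWithin (mem_nhdsWithin_of_mem_nhds (Iio_mem_nhds htT)))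
    rw [hyl t htT]
    refine h1.congr_of_eventuallyEq ?_ (hyl t htT)
    filter_upwards [mem_nhdsWithin_of_mem_nhds (Iio_mem_nhds htT)] with s hs using hyl s hs
  · have hyT : y t = g t := (hyr t le_rfl).trans hzT
    have hyg : ∀ s ∈ Ioo t₀ t, y s = g s := fun s hs =>
      (hyl s hs.2).trans (hxg ⟨hs.1.le, hs.2⟩)
    have hder : ∀ s ∈ Ioo t₀ t, HasDerivAt y (v s (g s)) s := fun s hs => by
      have h1 := (hx s ⟨hs.1.le, hs.2⟩).hasDerivAt (Ico_mem_nhds hs.1 hs.2)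
      rw [hxg ⟨hs.1.le, hs.2⟩] at h1
      refine h1.congr_of_eventuallyEq ?_
      filter_upwards [Iio_mem_nhds hs.2] with r hr using hyl r hr
    have hIoo : Ioo t₀ t ∈ 𝓝[<] t := Ioo_mem_nhdsLT hT
    -- At the junction the left derivative is the limit of the derivatives on the left.
    have hl : HasDerivWithinAt y (v t (y t)) (Iic t) t := by
      refine hasDerivWithinAt_Iic_of_tendsto_deriv (s := Ioo t₀ t)
        (fun s hs => (hder s hs).differentiableAt.differentiableWithinAt) ?_ hIoo ?_
      · exact hg.continuous.continuousWithinAt.congr hyg hyT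
      · have h1 : Tendsto (fun s => v s (g s)) (𝓝[<] t) (𝓝 (v t (y t))) := by
          rw [hyT]
          exact ((hv.comp (continuous_id.prodMk hg.continuous)).tendsto t).mono_left
            nhdsWithin_le_nhds
        refine h1.congr' ?_
        filter_upwards [hIoo] with s hs using (hder s hs).deriv.symm
    have hr : HasDerivWithinAt y (v t (y t)) (Ici t) t := by
      rw [hyr t le_rfl]
      exact (hz t self_mem_Ici).congr (fun s hs => hyr s hs) (hyr t le_rfl)
    exact (hl.union hr).mono fun s _ => le_total s t
  · have h1 : HasDerivWithinAt z (v t (z t)) (Ici t₀) t :=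
      (hz t htT.le).mono_of_mem_nhdsWithin (mem_nhdsWithin_of_mem_nhds (Ici_mem_nhds htT))
    rw [hyr t htT.le]
    refine h1.congr_of_eventuallyEq ?_ (hyr t htT.le)
    filter_upwards [mem_nhdsWithin_of_mem_nhds (Ioi_mem_nhds htT)] with s hs using hyr s hs.le

end Extension

/-! ### Truncation of the vector field to a ball -/

section Truncation

variable {E : Type*} [NormedAddCommGroup E] [NormedSpace ℝ E]

/-- The radial retraction onto the closed ball of radius `r`. -/
def radialRetraction (r : ℝ) (y : E) : E := (r / max r ‖y‖) • y

lemma continuous_radialRetraction {r : ℝ} (hr : 0 < r) :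
    Continuous (radialRetraction r : E → E) := by
  unfold radialRetraction
  refine (continuous_const.div (by fun_prop) fun y => ?_).smul continuous_id
  exact (hr.trans_le (le_max_left _ _)).ne'

lemma norm_radialRetraction_le {r : ℝ} (hr : 0 < r) (y : E) : ‖radialRetraction r y‖ ≤ r := by
  have h : 0 < max r ‖y‖ := hr.trans_le (le_max_left _ _)
  rw [radialRetraction, norm_smul, Real.norm_of_nonneg (by positivity), div_mul_eq_mul_div,
    div_le_iff₀ h]
  gcongr
  exact le_max_right _ _

lemma radialRetraction_of_norm_le {r : ℝ} (hr : 0 < r) {y : E} (hy : ‖y‖ ≤ r) :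
    radialRetraction r y = y := by
  rw [radialRetraction, max_eq_left hy, div_self hr.ne', one_smul]

/-- The field `v`, frozen for negative times and truncated outside the closed ball of radius
`r`. -/
def truncatedField (v : ℝ → E → E) (r t : ℝ) (y : E) : E := v (max t 0) (radialRetraction r y)

lemma truncatedField_eq {v : ℝ → E → E} {r t : ℝ} (hr : 0 < r) (ht : 0 ≤ t) {y : E}
    (hy : ‖y‖ ≤ r) : truncatedField v r t y = v t y := by
  rw [truncatedField, max_eq_left ht, radialRetraction_of_norm_le hr hy]

lemma continuous_truncatedField {v : ℝ → E → E} {r : ℝ} (hr : 0 < r)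
    (hv : ContinuousOn (fun q : ℝ × E => v q.1 q.2) (Ici 0 ×ˢ Metric.closedBall 0 r)) :
    Continuous fun q : ℝ × E => truncatedField v r q.1 q.2 := by
  have h : Continuous fun q : ℝ × E => (max q.1 0, radialRetraction r q.2) :=
    (continuous_fst.max continuous_const).prodMk
      ((continuous_radialRetraction hr).comp continuous_snd)
  exact hv.comp_continuous h fun q =>
    ⟨mem_Ici.2 (le_max_right _ _), by simpa using norm_radialRetraction_le hr q.2⟩

lemma exists_norm_truncatedField_le [FiniteDimensional ℝ E] {v : ℝ → E → E} {r : ℝ} (hr : 0 < r)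
    (hv : ContinuousOn (fun q : ℝ × E => v q.1 q.2) (Ici 0 ×ˢ Metric.closedBall 0 r)) (s T : ℝ) :
    ∃ M, ∀ t, s ≤ t → t ≤ T → ∀ y, ‖truncatedField v r t y‖ ≤ M := by
  have hc : IsCompact (Icc 0 (max T 0) ×ˢ Metric.closedBall (0 : E) r) :=
    isCompact_Icc.prod (isCompact_closedBall _ _)
  obtain ⟨M, hM⟩ := hc.exists_bound_of_continuousOn
    (hv.mono (prod_mono_left fun t ht => ht.1))
  exact ⟨M, fun t _ htT y => hM (max t 0, radialRetraction r y)
    ⟨⟨le_max_right _ _, max_le_max_right 0 htT⟩, by simpa using norm_radialRetraction_le hr y⟩⟩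

end Truncation

/-! ### From decay estimates to stability -/

section Stability

variable {E : Type*} [NormedAddCommGroup E] [NormedSpace ℝ E]

/-- A first-exit argument: the decay estimate inside a ball keeps the curve in a small ball. -/
lemma norm_lt_of_decay {v : ℝ → E → E} {x : ℝ → E} {r C δ η ε t₀ T : ℝ} (hC : 0 < C)
    (hεr : ε ≤ r) (hδ : δ ≤ ε) (hδη : C * (δ + η) < ε)
    (hdecay : ∀ s ∈ Icc t₀ T, (∀ t ∈ Icc t₀ s, ‖x t‖ ≤ r ∧
      HasDerivWithinAt x (v t (x t)) (Icc t₀ s) t) →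
      ‖x s‖ ≤ C * (Real.exp (-(s - t₀) / 2) * ‖x t₀‖ + η))
    (hx0 : ‖x t₀‖ < δ) (hxc : ContinuousOn x (Icc t₀ T))
    (hx : ∀ t ∈ Icc t₀ T, ‖x t‖ ≤ r → HasDerivWithinAt x (v t (x t)) (Icc t₀ T) t) :
    ∀ t ∈ Icc t₀ T, ‖x t‖ < ε := by
  by_contra! hcon
  obtain ⟨t₁, ht₁, hε₁⟩ := hcon
  have hcomp : IsCompact {t ∈ Icc t₀ T | ε ≤ ‖x t‖} := by
    refine isCompact_Icc.of_isClosed_subset ?_ (fun t ht => ht.1)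
    have := hxc.norm.preimage_isClosed_of_isClosed isClosed_Icc (isClosed_Ici (a := ε))
    exact this
  obtain ⟨u, ⟨hu, huε⟩, hmin⟩ := hcomp.exists_isLeast ⟨t₁, ht₁, hε₁⟩
  have hsub : Icc t₀ u ⊆ Icc t₀ T := Icc_subset_Icc le_rfl hu.2
  have hueq : ‖x u‖ = ε := by
    obtain ⟨c, hc, hcε⟩ := intermediate_value_Icc hu.1 (hxc.norm.mono hsub)
      (show ε ∈ Icc ‖x t₀‖ ‖x u‖ from ⟨(hx0.trans_le hδ).le, huε⟩)
    have : u ≤ c := hmin ⟨hsub hc, hcε.ge⟩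
    rwa [le_antisymm hc.2 this] at hcε
  have hle : ∀ t ∈ Icc t₀ u, ‖x t‖ ≤ r := by
    intro t ht
    rcases ht.2.lt_or_eq with h | rfl
    · by_contra! hlt
      exact absurd (hmin ⟨hsub ht, hεr.trans hlt.le⟩) h.not_ge
    · exact hueq.trans_le hεr
  have h := hdecay u hu fun t ht => ⟨hle t ht, (hx t (hsub ht) (hle t ht)).mono hsub⟩
  have h1 : Real.exp (-(u - t₀) / 2) * ‖x t₀‖ ≤ δ :=
    (mul_le_of_le_one_left (norm_nonneg _)
      (Real.exp_le_one_iff.2 (by linarith [hu.1]))).trans hx0.le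
  have h2 : C * (Real.exp (-(u - t₀) / 2) * ‖x t₀‖ + η) ≤ C * (δ + η) := by gcongr
  linarith

/-- A decay estimate inside a ball, with an error that vanishes for late initial times, gives
eventual uniform-asymptotic stability. -/
theorem evUAS_of_decay [FiniteDimensional ℝ E] {v : ℝ → E → E} {P : Set E} {r C : ℝ} (hr : 0 < r)
    (hC : 0 < C) (hP : Metric.closedBall 0 r ⊆ P)
    (hv : ContinuousOn (fun q : ℝ × E => v q.1 q.2) (Ici 0 ×ˢ Metric.closedBall 0 r))
    (hdecay : ∀ η > 0, ∃ a ≥ 0, ∀ t₀ ≥ a, ∀ T ≥ t₀, ∀ x : ℝ → E,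
      (∀ t ∈ Icc t₀ T, ‖x t‖ ≤ r ∧ HasDerivWithinAt x (v t (x t)) (Icc t₀ T) t) →
      ‖x T‖ ≤ C * (Real.exp (-(T - t₀) / 2) * ‖x t₀‖ + η)) :
    EvUAS v P := by
  have hPmem : ∀ y : E, ‖y‖ ≤ r → y ∈ P := fun y hy => hP (by simpa using hy)
  -- The equation is required only while the curve is in the ball, so the same statement confines
  -- solutions of `v` and of its truncation.
  have trap : ∀ ε > 0, ε ≤ r → ∃ α ≥ 0, ∃ δ > 0, ∀ t₀ ≥ α, ∀ T, ∀ x : ℝ → E, ‖x t₀‖ < δ →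
      ContinuousOn x (Icc t₀ T) →
      (∀ t ∈ Icc t₀ T, ‖x t‖ ≤ r → HasDerivWithinAt x (v t (x t)) (Icc t₀ T) t) →
      ∀ t ∈ Icc t₀ T, ‖x t‖ < ε := by
    intro ε hε hεr
    obtain ⟨a, ha0, ha⟩ := hdecay (ε / (4 * C)) (by positivity)
    refine ⟨a, ha0, min ε (ε / (4 * C)), by positivity, fun t₀ ht₀ T x hx0 hxc hx => ?_⟩
    refine norm_lt_of_decay hC hεr (min_le_left _ _) ?_
      (fun s hs h => ha t₀ ht₀ s hs.1 x h) hx0 hxc hx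
    calc C * (min ε (ε / (4 * C)) + ε / (4 * C)) ≤ C * (ε / (4 * C) + ε / (4 * C)) := by
          gcongr
          exact min_le_right _ _
      _ = ε / 2 := by
          field_simp
          ring
      _ < ε := half_lt_self hε
  have main : ∀ ε > 0, ε ≤ r → ∃ α ≥ 0, ∃ δ > 0, ∀ t₀ ≥ α, ∀ x₀ : E, ‖x₀‖ < δ →
      ForwardComplete v P t₀ x₀ ∧
      ∀ x, IsSolutionOn v P x (Ici t₀) → x t₀ = x₀ → ∀ t ≥ t₀, ‖x t‖ < ε := by
    intro ε hε hεr
    obtain ⟨α, hα, δ, hδ, htrap⟩ := trap ε hε hεr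
    refine ⟨α, hα, δ, hδ, fun t₀ ht₀ x₀ hx₀ => ?_⟩
    have ht₀0 : 0 ≤ t₀ := hα.trans ht₀
    have htrunc : ∀ x : ℝ → E, x t₀ = x₀ →
        (∀ t ∈ Ici t₀, HasDerivWithinAt x (truncatedField v r t (x t)) (Ici t₀) t) →
        IsSolutionOn v P x (Ici t₀) := by
      intro x hx0 hx t ht
      have hlt := htrap t₀ ht₀ t x (hx0 ▸ hx₀)
        (fun s hs => (hx s hs.1).continuousWithinAt.mono Icc_subset_Ici_self)
        (fun s hs hs' => by
          rw [← truncatedField_eq (v := v) hr (ht₀0.trans hs.1) hs']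
          exact (hx s hs.1).mono Icc_subset_Ici_self) t ⟨ht, le_rfl⟩
      have hle : ‖x t‖ ≤ r := hlt.le.trans hεr
      refine ⟨hPmem _ hle, ?_⟩
      rw [← truncatedField_eq (v := v) hr (ht₀0.trans ht) hle]
      exact hx t ht
    refine ⟨⟨?_, ?_⟩, ?_⟩
    · obtain ⟨x, hx0, hx⟩ := exists_solution_of_continuous (continuous_truncatedField hr hv) t₀ x₀
        (exists_norm_truncatedField_le hr hv t₀)
      exact ⟨x, htrunc x hx0 hx, hx0⟩
    · intro T hT x hx hx0
      have hlt : ∀ t ∈ Ico t₀ T, ‖x t‖ < ε := fun t ht => by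
        have hsub : Icc t₀ t ⊆ Ico t₀ T := fun s hs => ⟨hs.1, hs.2.trans_lt ht.2⟩
        exact htrap t₀ ht₀ t x (hx0 ▸ hx₀)
          (fun s hs => (hx s (hsub hs)).2.continuousWithinAt.mono hsub)
          (fun s hs _ => (hx s (hsub hs)).2.mono hsub) t ⟨ht.1, le_rfl⟩
      obtain ⟨y, hxy, hy⟩ := exists_solution_extension (continuous_truncatedField hr hv) hT
        (exists_norm_truncatedField_le hr hv) (x := x) (fun t ht => by
          rw [truncatedField_eq hr (ht₀0.trans ht.1) ((hlt t ht).le.trans hεr)]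
          exact (hx t ht).2)
      exact ⟨y, htrunc y (by rw [← hxy ⟨le_rfl, hT⟩, hx0]) hy, hxy⟩
    · intro x hx hx0 t ht
      exact htrap t₀ ht₀ t x (hx0 ▸ hx₀)
        (fun s hs => (hx s hs.1).2.continuousWithinAt.mono Icc_subset_Ici_self)
        (fun s hs _ => (hx s hs.1).2.mono Icc_subset_Ici_self) t ⟨ht, le_rfl⟩
  refine ⟨fun ε hε => ?_, ?_⟩
  · obtain ⟨α, hα, δ, hδ, h⟩ := main (min ε r) (lt_min hε hr) (min_le_right _ _)
    exact ⟨α, hα, δ, hδ, fun t₀ ht₀ x₀ hx₀ => ⟨(h t₀ ht₀ x₀ hx₀).1, fun x hx hx0 t ht =>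
      ((h t₀ ht₀ x₀ hx₀).2 x hx hx0 t ht).trans_le (min_le_left _ _)⟩⟩
  · obtain ⟨α, hα, δ, hδ, h⟩ := main r hr le_rfl
    refine ⟨δ, hδ, α, hα, fun ε hε => ?_⟩
    obtain ⟨a, ha0, ha⟩ := hdecay (ε / (4 * C)) (by positivity)
    have hlim : Tendsto (fun s : ℝ => C * (Real.exp (-s / 2) * r)) atTop (𝓝 0) := by
      have h1 : Tendsto (fun s : ℝ => -s / 2) atTop atBot :=
        tendsto_neg_atTop_atBot.atBot_div_const (by norm_num)
      simpa using ((Real.tendsto_exp_atBot.comp h1).mul_const r).const_mul C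
    obtain ⟨τ, hτ⟩ := eventually_atTop.1 (hlim.eventually_lt_const (half_pos hε))
    -- The initial time bound `α` must not depend on `ε`, whereas `a` does. The estimate is
    -- therefore restarted at `t₀ + a`, the solution being in the ball meanwhile.
    refine ⟨a + max τ 0, by positivity, fun t₀ ht₀ x₀ hx₀ =>
      ⟨(h t₀ ht₀ x₀ hx₀).1, fun x hx hx0 t ht => ?_⟩⟩
    have hτ0 := le_max_right τ 0
    have hττ := le_max_left τ 0
    have hball : ∀ s ≥ t₀, ‖x s‖ ≤ r := fun s hs => ((h t₀ ht₀ x₀ hx₀).2 x hx hx0 s hs).le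
    have hsub : Icc (t₀ + a) t ⊆ Ici t₀ := fun s hs => by
      rw [mem_Ici]
      linarith [hs.1]
    have h1 := ha (t₀ + a) (by linarith [hα.trans ht₀]) t (by linarith) x fun s hs =>
      ⟨hball s (hsub hs), (hx s (hsub hs)).2.mono hsub⟩
    have h2 := hτ (t - (t₀ + a)) (by linarith)
    have h3 : C * (Real.exp (-(t - (t₀ + a)) / 2) * ‖x (t₀ + a)‖)
        ≤ C * (Real.exp (-(t - (t₀ + a)) / 2) * r) := by
      gcongr
      exact hball _ (by linarith)
    have h4 : C * (ε / (4 * C)) = ε / 4 := by field_simp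
    rw [mul_add, h4] at h1
    linarith

end Stability

/-! ### Stability of the linearised closed loop -/

section ClosedLoop

variable {m n : ℕ}

theorem evUAS_closedLoop {F : State m n × Input m → Input m} {G : State m n → Input m}
    {P : Set (State m n)} (hP : IsOpen P) (hP0 : (0 : State m n) ∈ P)
    (hFG : ∀ X ∈ P, F (X, G X) = chainGain m n X) {D : ℝ → Matrix (Fin m) (Fin m) ℝ}
    {K : State m n → Input m} (h : AdmissiblePerturbation D K) :
    EvUAS (closedLoop F G (perturbation D K)) P := by
  obtain ⟨r, hr, hrP⟩ := Metric.nhds_basis_closedBall.mem_iff.1 (hP.mem_nhds hP0)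
  obtain ⟨C, hC, hCdecay⟩ := exists_chain_decay m n
  have hfield : ∀ t, ∀ X ∈ P,
      closedLoop F G (perturbation D K) t X = chainField X (perturbation D K t X) := by
    intro t X hX
    funext i
    simp [closedLoop, chainField, hFG X hX]
  have hpert := continuousOn_perturbation h
  refine evUAS_of_decay hr hC hrP ?_ fun η hη => ?_
  · have hc : ContinuousOn (fun q : ℝ × State m n =>
        chainField q.2 (perturbation D K q.1 q.2)) (Ici 0 ×ˢ Metric.closedBall 0 r) := by
      refine continuousOn_pi.2 fun i => ?_
      simp only [chainField]
      split_ifs with hi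
      · fun_prop
      · exact (by fun_prop : Continuous fun q : ℝ × State m n =>
          chainGain m n q.2).continuousOn.add (hpert.mono (prod_mono_right (subset_univ _)))
    exact hc.congr fun q hq => hfield q.1 q.2 (hrP hq.2)
  · obtain ⟨a, ha0, ha⟩ := h.exists_norm_integral_le r hη
    refine ⟨a, ha0, fun t₀ ht₀ T hT x hx => ?_⟩
    have hx' : ∀ t ∈ Icc t₀ T, HasDerivWithinAt x
        (chainField (x t) (perturbation D K t (x t))) (Icc t₀ T) t := fun t ht => by
      rw [← hfield t (x t) (hrP (by simpa using (hx t ht).1))]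
      exact (hx t ht).2
    refine hCdecay (w := fun t => perturbation D K t (x t)) ?_ hx' ?_ T ⟨hT, le_rfl⟩
    · have hxc : ContinuousOn x (Icc t₀ T) := fun t ht => (hx' t ht).continuousWithinAt
      exact hpert.comp (continuousOn_id.prodMk hxc)
        fun t ht => ⟨ha0.trans (ht₀.trans ht.1), mem_univ _⟩
    · intro s s' hs hss' hs' hs1
      have hsub : Icc s s' ⊆ Icc t₀ T := Icc_subset_Icc hs hs'
      exact ha s (ht₀.trans hs) s' hss' hs1 x (fun t ht => (hx t (hsub ht)).1)
        fun t ht => (hx' t (hsub ht)).mono hsub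

end ClosedLoop

/-! ### Hadamard's theorem via covering spaces -/

section GlobalInverse

variable {E F : Type*} [NormedAddCommGroup E] [NormedSpace ℝ E] [FiniteDimensional ℝ E]
  [NormedAddCommGroup F] [NormedSpace ℝ F] [FiniteDimensional ℝ F]

/-- **Hadamard's global inverse function theorem**: a `C¹` map between finite-dimensional spaces
that is proper and has invertible derivative everywhere is bijective. -/
theorem bijective_of_tendsto_cobounded {f : E → F} (hf : ContDiff ℝ 1 f)
    (hf' : ∀ x, Function.Bijective (fderiv ℝ f x))
    (hlim : Tendsto f (Bornology.cobounded E) (Bornology.cobounded F)) :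
    Function.Bijective f := by
  have := FiniteDimensional.proper ℝ E
  have := FiniteDimensional.proper ℝ F
  have hproper : IsProperMap f := by
    rw [isProperMap_iff_tendsto_cocompact]
    refine ⟨hf.continuous, ?_⟩
    rwa [← Metric.cobounded_eq_cocompact, ← Metric.cobounded_eq_cocompact]
  have hloc : ∀ x, ∃ φ : OpenPartialHomeomorph E F, x ∈ φ.source ∧ f = φ := by
    intro x
    have hs : HasStrictFDerivAt f
        ((LinearEquiv.ofBijective (fderiv ℝ f x : E →ₗ[ℝ] F) (hf' x)).toContinuousLinearEquiv :
          E →L[ℝ] F) x := by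
      convert! hf.contDiffAt.hasStrictFDerivAt (x := x) one_ne_zero
    exact ⟨hs.toOpenPartialHomeomorph f, hs.mem_toOpenPartialHomeomorph_source, rfl⟩
  have hfin : ∀ y, (f ⁻¹' {y}).Finite := fun y =>
    (hproper.isCompact_preimage isCompact_singleton).finite
      (.of_openPartialHomeomorph f subset_rfl fun x _ => by
        obtain ⟨φ, h1, h2⟩ := hloc x
        exact ⟨φ, h1, h2.symm⟩)
  have hcov : IsCoveringMap f := by
    rw [isCoveringMap_iff_isCoveringMapOn_univ]
    exact hproper.isClosedMap.isCoveringMapOn_of_isLocalHomeomorphOn (fun y _ => hfin y)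
      fun x _ => hloc x
  -- The space `F` is simply connected, so its identity lifts to a section of `f` through any
  -- prescribed point.
  have hsec : ∀ e : E, ∃ g : C(F, E), g (f e) = e ∧ f ∘ g = id := fun e => by
    obtain ⟨g, hg, -⟩ := hcov.existsUnique_continuousMap_lifts (ContinuousMap.id F) (f e) e rfl
    exact ⟨g, hg.1, hg.2⟩
  constructor
  · intro e e' hee'
    obtain ⟨g, hge, hg⟩ := hsec e
    -- Both the identity and `g ∘ f` lift `f` and fix `e`; uniqueness of lifts gives `g ∘ f = id`,
    -- hence injectivity.
    obtain ⟨k, -, hk⟩ := hcov.existsUnique_continuousMap_lifts ⟨f, hf.continuous⟩ e e rfl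
    have h1 := hk (ContinuousMap.id E) ⟨rfl, rfl⟩
    have h2 := hk (g.comp ⟨f, hf.continuous⟩) ⟨hge, by
      funext x
      exact congrFun hg (f x)⟩
    have h3 : e' = g (f e') := congrArg (fun q : C(E, E) => q e') (h1.trans h2.symm)
    rw [h3, ← hee', hge]
  · intro y
    obtain ⟨g, -, hg⟩ := hsec 0
    exact ⟨g y, congrFun hg y⟩

end GlobalInverse

/-! ### Local and global linearising feedback -/

section Feedback

variable {X U V : Type*} [NormedAddCommGroup X] [NormedSpace ℝ X] [CompleteSpace X]
  [NormedAddCommGroup U] [NormedSpace ℝ U] [FiniteDimensional ℝ U]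
  [NormedAddCommGroup V] [NormedSpace ℝ V] [FiniteDimensional ℝ V]

/-- Local solvability of `F (x, u) = L x` for `u` as a `C¹` function of `x`. -/
theorem exists_local_feedback {F : X × U → V} (hF : ContDiff ℝ 1 F) (L : X →L[ℝ] V) {x₀ : X}
    {u₀ : U} (h₀ : F (x₀, u₀) = L x₀)
    (hJ : Function.Bijective (fderiv ℝ (fun u => F (x₀, u)) u₀)) :
    ∃ ψ : X → U, ψ x₀ = u₀ ∧ ContDiffAt ℝ 1 ψ x₀ ∧ ∀ᶠ x in 𝓝 x₀, F (x, ψ x) = L x := by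
  have := FiniteDimensional.complete ℝ U
  have := FiniteDimensional.complete ℝ V
  set Φ : X × U → V := fun q => F q - L q.1 with hΦ
  have hΦc : ContDiff ℝ 1 Φ := hF.sub (L.contDiff.comp contDiff_fst)
  have hΦ0 : Φ (x₀, u₀) = 0 := by simp [hΦ, h₀]
  have hpart : fderiv ℝ Φ (x₀, u₀) ∘L .inr ℝ X U = fderiv ℝ (fun u => F (x₀, u)) u₀ := by
    have h1 : HasFDerivAt (fun u => Φ (x₀, u)) (fderiv ℝ Φ (x₀, u₀) ∘L .inr ℝ X U) u₀ :=
      ((hΦc.differentiable one_ne_zero) (x₀, u₀)).hasFDerivAt.comp u₀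
        (hasFDerivAt_prodMk_right x₀ u₀)
    have h2 : HasFDerivAt (fun u => F (x₀, u)) (fderiv ℝ Φ (x₀, u₀) ∘L .inr ℝ X U) u₀ := by
      simpa [hΦ] using h1.add_const (L x₀)
    exact h2.fderiv.symm
  have hinv : (fderiv ℝ Φ (x₀, u₀) ∘L .inr ℝ X U).IsInvertible := by
    rw [hpart]
    exact ⟨(LinearEquiv.ofBijective
      (fderiv ℝ (fun u => F (x₀, u)) u₀ : U →ₗ[ℝ] V) hJ).toContinuousLinearEquiv, by ext; rfl⟩
  have hat : ContDiffAt ℝ 1 Φ (x₀, u₀) := hΦc.contDiffAt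
  refine ⟨hat.implicitFunction one_ne_zero hinv, hat.implicitFunction_apply_self one_ne_zero hinv,
    hat.contDiffAt_implicitFunction one_ne_zero hinv, ?_⟩
  filter_upwards [hat.eventually_apply_implicitFunction one_ne_zero hinv] with x hx
  rw [hΦ0] at hx
  exact sub_eq_zero.1 hx

/-- Global solvability of `F (x, u) = L x` for `u` as a `C¹` function of `x`. -/
theorem exists_global_feedback {F : X × U → V} (hF : ContDiff ℝ 1 F) (L : X →L[ℝ] V)
    (hcoer : ∀ x, Tendsto (fun u => (1 / 2 : ℝ) * ‖F (x, u)‖ ^ 2) (Bornology.cobounded U) atTop)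
    (hJ : ∀ x u, Function.Bijective (fderiv ℝ (fun u => F (x, u)) u)) :
    ∃ G : X → U, ContDiff ℝ 1 G ∧ ∀ x u, F (x, u) = L x ↔ u = G x := by
  have hbij : ∀ x, Function.Bijective fun u => F (x, u) := fun x => by
    refine bijective_of_tendsto_cobounded (hF.comp (contDiff_prodMk_right x)) (hJ x) ?_
    rw [← tendsto_norm_atTop_iff_cobounded, tendsto_atTop]
    intro R
    filter_upwards [(hcoer x).eventually_ge_atTop ((1 / 2 : ℝ) * R ^ 2)] with u hu
    by_contra! h
    nlinarith [norm_nonneg (F (x, u))]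
  choose G hG using fun x => (hbij x).2 (L x)
  have huniq : ∀ x u, F (x, u) = L x ↔ u = G x := fun x u =>
    ⟨fun h => (hbij x).1 (h.trans (hG x).symm), fun h => h ▸ hG x⟩
  refine ⟨G, contDiff_iff_contDiffAt.2 fun x => ?_, huniq⟩
  -- Uniqueness of the solution forces `G` to agree near `x` with the implicit function there, and
  -- so to be `C¹`.
  obtain ⟨ψ, -, hψ, hev⟩ := exists_local_feedback hF L (hG x) (hJ x (G x))
  refine hψ.congr_of_eventuallyEq ?_
  filter_upwards [hev] with y hy using ((huniq y _).1 hy).symm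

end Feedback

/-! ### Necessity of the diminishing property -/

section Necessity

variable {m n : ℕ}

/-- If some solution of the perturbed system converges to the origin, then the perturbation is
diminishing. -/
theorem diminishing_of_evUA {F : State m n × Input m → Input m} (hF : Continuous F)
    (hF0 : F (0, 0) = 0) (hn : 0 < n) {w : ℝ → Input m} (hw : ContinuousOn w (Ici 0))
    {P : Set (State m n)} {G : State m n → Input m} (hP : IsOpen P) (hP0 : (0 : State m n) ∈ P)
    (hG : ContinuousOn G P) (hG0 : G 0 = 0) (h : EvUA (closedLoop F G fun t _ => w t) P) :
    Diminishing w := by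
  obtain ⟨δ, hδ, α, hα, h⟩ := h
  obtain ⟨x, hx, hx0⟩ : ∃ x, IsSolutionOn (closedLoop F G fun t _ => w t) P x (Ici α) ∧ x α = 0 :=
    ((h 1 one_pos).choose_spec.2 α le_rfl 0 (by simpa using hδ)).1.1
  have hlim : ∀ ε > 0, ∃ T ≥ 0, ∀ t ≥ α + T, ‖x t‖ < ε := fun ε hε => by
    obtain ⟨T, hT, hT'⟩ := h ε hε
    exact ⟨T, hT, (hT' α le_rfl 0 (by simpa using hδ)).2 x hx hx0⟩
  set φ : State m n → Input m := fun X => F (X, G X) with hφ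
  have hφP : ContinuousOn φ P := hF.comp_continuousOn (continuousOn_id.prodMk hG)
  have hφ0 : φ 0 = 0 := by simp [hφ, hG0, hF0]
  have hxc : ContinuousOn x (Ici α) := fun t ht => (hx t ht).2.continuousWithinAt
  have hφx : ContinuousOn (fun t => φ (x t)) (Ici α) := hφP.comp hxc fun t ht => (hx t ht).1
  set l : Fin n := ⟨n - 1, by omega⟩ with hl
  have hder : ∀ t > α, HasDerivAt (fun t => x t l) (φ (x t) + w t) t := fun t ht => by
    have h1 := hasDerivAt_pi.1 ((hx t ht.le).2.hasDerivAt (Ici_mem_nhds ht)) l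
    have h2 : ¬ ((l : ℕ) + 1 < n) := by
      rw [hl]
      simp only
      omega
    rwa [closedLoop, dif_neg h2] at h1
  refine diminishing_of_norm_integral_le hw fun η hη => ?_
  obtain ⟨ρ, hρ, hρφ⟩ := Metric.continuousAt_iff.1 (hφP.continuousAt (hP.mem_nhds hP0)) (η / 3)
    (by positivity)
  obtain ⟨T, hT, hT'⟩ := hlim (min ρ (η / 3)) (by positivity)
  refine ⟨α + T + 1, fun s hs s' hss' hs' => ?_⟩
  have hsub : Icc s s' ⊆ Ici α := fun t ht => by
    rw [mem_Ici]
    linarith [ht.1]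
  have hi1 : IntervalIntegrable (fun t => φ (x t)) MeasureTheory.volume s s' :=
    (hφx.mono (by rwa [uIcc_of_le hss'])).intervalIntegrable
  have hi2 : IntervalIntegrable w MeasureTheory.volume s s' :=
    (hw.mono (by
      rw [uIcc_of_le hss']
      exact hsub.trans (Ici_subset_Ici.2 hα))).intervalIntegrable
  have hftc := intervalIntegral.integral_eq_sub_of_hasDerivAt (f := fun t => x t l)
    (fun t ht => hder t (by
      rw [uIcc_of_le hss'] at ht
      linarith [ht.1])) (hi1.add hi2)
  rw [intervalIntegral.integral_add hi1 hi2] at hftc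
  have hsmall : ∀ t ≥ s, ‖x t‖ ≤ η / 3 := fun t ht =>
    ((hT' t (by linarith)).trans_le (min_le_right _ _)).le
  have hφint : ‖∫ t in s..s', φ (x t)‖ ≤ η / 3 := by
    have h1 := intervalIntegral.norm_integral_le_of_norm_le_const (f := fun t => φ (x t))
      (a := s) (b := s') (C := η / 3) (fun t ht => by
        rw [uIoc_of_le hss'] at ht
        have h2 := @hρφ (x t) (by
          rw [dist_zero_right]
          exact (hT' t (by linarith [ht.1])).trans_le (min_le_left _ _))
        rw [hφ0, dist_zero_right] at h2
        exact h2.le)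
    rw [abs_of_nonneg (by linarith)] at h1
    nlinarith
  -- Each of the three terms on the right has norm at most `η / 3`.
  have e : ∫ t in s..s', w t = x s' l - x s l - ∫ t in s..s', φ (x t) :=
    eq_sub_of_add_eq' hftc
  rw [e]
  have h1 := (norm_le_pi_norm (x s') l).trans (hsmall s' hss')
  have h2 := (norm_le_pi_norm (x s) l).trans (hsmall s le_rfl)
  have h3 := norm_sub_le (x s' l - x s l) (∫ t in s..s', φ (x t))
  have h4 := norm_sub_le (x s' l) (x s l)
  linarith

end Necessity

end

theorem theorem1 (m n : ℕ) (hm : 1 ≤ m) (hn : 2 ≤ n)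
    (F : State m n × Input m → Input m) (hF : ContDiff ℝ 1 F) (hF0 : F (0, 0) = 0)
    (hJ : Function.Bijective (fderiv ℝ (fun U : Input m => F (0, U)) 0)) :
    -- the feedback law, its domain, and when it is global
    (∃ (P : Set (State m n)) (G : State m n → Input m),
      IsOpen P ∧ (0 : State m n) ∈ P ∧ ContDiffOn ℝ 1 G P ∧ G 0 = 0 ∧
      (∃ L : State m n →L[ℝ] Input m, ∀ X ∈ P, F (X, G X) = L X) ∧
      (∀ (D : ℝ → Matrix (Fin m) (Fin m) ℝ) (K : State m n → Input m),
        AdmissiblePerturbation D K → EvUAS (closedLoop F G (perturbation D K)) P) ∧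
      ((∀ X : State m n,
          Tendsto (fun U : Input m => (1 / 2 : ℝ) * ‖F (X, U)‖ ^ 2)
            (Bornology.cobounded (Input m)) atTop) →
        (∀ (X : State m n) (V : Input m),
          Function.Bijective (fderiv ℝ (fun U : Input m => F (X, U)) V)) →
        P = univ)) ∧
    -- necessity of the diminishing property for purely time-dependent perturbations
    (∀ (w : ℝ → Input m), ContinuousOn w (Ici 0) →
      ∀ (P : Set (State m n)) (G : State m n → Input m),
        IsOpen P → (0 : State m n) ∈ P → ContinuousOn G P → G 0 = 0 →
        EvUAS (closedLoop F G (fun t _ => w t)) P → Diminishing w) := by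
  refine ⟨?_, fun w hw P G hP hP0 hG hG0 h =>
    diminishing_of_evUA hF.continuous hF0 (by omega) hw hP hP0 hG hG0 h.2⟩
  -- One feedback has to serve both the local and the global claim, so the global hypotheses decide
  -- which construction is used; if they fail, the clause `P = univ` is vacuous.
  by_cases hglobal : (∀ X : State m n,
      Tendsto (fun U : Input m => (1 / 2 : ℝ) * ‖F (X, U)‖ ^ 2)
        (Bornology.cobounded (Input m)) atTop) ∧
      ∀ (X : State m n) (V : Input m),
        Function.Bijective (fderiv ℝ (fun U : Input m => F (X, U)) V)
  · obtain ⟨G, hG, hFG⟩ := exists_global_feedback hF (chainGain m n) hglobal.1 hglobal.2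
    have hFG' : ∀ X ∈ (univ : Set (State m n)), F (X, G X) = chainGain m n X :=
      fun X _ => (hFG X _).2 rfl
    exact ⟨univ, G, isOpen_univ, mem_univ _, hG.contDiffOn,
      ((hFG 0 0).1 (by rw [hF0, map_zero])).symm, ⟨_, hFG'⟩,
      fun D K h => evUAS_closedLoop isOpen_univ (mem_univ _) hFG' h, fun _ _ => rfl⟩
  · obtain ⟨G, hG0, hG, hFG⟩ := exists_local_feedback hF (chainGain m n) (x₀ := 0) (u₀ := 0)
      (by rw [hF0, map_zero]) hJ
    obtain ⟨P, hPsub, hP, hP0⟩ := mem_nhds_iff.1 ((hG.eventually (by simp)).and hFG)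
    exact ⟨P, G, hP, hP0, fun X hX => (hPsub hX).1.contDiffWithinAt, hG0,
      ⟨_, fun X hX => (hPsub hX).2⟩,
      fun D K h => evUAS_closedLoop hP hP0 (fun X hX => (hPsub hX).2) h,
      fun h1 h2 => absurd ⟨h1, h2⟩ hglobal⟩
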